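/- **Setting.** Let $\mathcal G=(\mathcal V,\mathcal E)$ be a finite connected simple graph on a linearly ordered vertex set, with neighbourhoods $\mathcal N_i$ and degrees $d_i$. Let $\mathcal V=\mathcal V_h\sqcup\mathcal V_c$ (honest and corrupt nodes), let $\mathcal E_h$ be the set of edges with both ends honest, $\mathcal E_c=\mathcal E\setminus\mathcal E_h$, and $\mathcal N_{j,h}=\mathcal N_j\cap\mathcal V_h$. For adjacent $i,j$ put $B_{i|j}=1$ if $i<j$ and $B_{i|j}=-1$ if $i>j$. Fix $c>0$, $\theta\in[0,1)$, $\gamma\in(0,1)$, $\Delta^{(0)}>0$, and let $\Delta_{\min}=0$, so that the cell width is $\Delta^{(t)}=\max\{\gamma^t\Delta^{(0)},\Delta_{\min}\}=\gamma^t\Delta^{(0)}$. Mutual information $\mathrm I(X;Y)\in[0,\infty]$ is the Kullback–Leibler divergence of the joint law of $(X,Y)$ from the product of the marginal laws. **Randomness.** The private data $S_j$ ($j\in\mathcal V$), the initial values $Z^{(0)}_{i|j}$ (one for each ordered pair of adjacent nodes), and the dithers $D^{(t)}_{i|j}$ are mutually independent real random variables; $Z^{(0)}_{i|j}\sim\mathcal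 N(0,\sigma_z^2)$ with $\sigma_z^2>0$, and $D^{(t)}_{i|j}$ is uniform on $[-\Delta^{(t)}/2,\Delta^{(t)}/2]$. **The ADQSP protocol.** Let $\hat Z^{(0)}=Z^{(0)}$, and for $t\ge 0$ and adjacent $i,j$ $$X_i^{(t+1)}=\frac{S_i-\sum_{k\in\mathcal N_i}B_{i|k}\hat Z^{(t)}_{i|k}}{1+cd_i},\qquad Z^{(t+1)}_{j|i}=\theta\hat Z^{(t)}_{j|i}+(1-\theta)\bigl(\hat Z^{(t)}_{i|j}+2cB_{i|j}X_i^{(t+1)}\bigr),$$ $$\Delta\hat Z^{(t+1)}_{j|i}=Q^{(t+1)}\bigl(Z^{(t+1)}_{j|i}-\hat Z^{(t)}_{j|i}+D^{(t+1)}_{j|i}\bigr)-D^{(t+1)}_{j|i},\qquad \hat Z^{(t+1)}_{j|i}=\hat Z^{(t)}_{j|i}+\Delta\hat Z^{(t+1)}_{j|i}.$$ Here $Q^{(t)}$ maps a real number to a nearest point of $\{\Delta^{(t)}(a+\tfrac12):a\in\mathcal A\}$ (on a tie, the larger one), where either $\mathcal A=\{-2^{l-1},\dots,2^{l-1}-1\}$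 for an integer $l\ge 1$ ($l$-bit quantizer), or $\mathcal A=\mathbb Z$ (overload-free quantizer, $l=\infty$; then the quantization error $\Delta\hat Z^{(t)}-\Delta Z^{(t)}$ is uniform on an interval of length $\Delta^{(t)}$ centred at $0$ and independent of the quantized variable). For $t_{\max}\in\{0,1,2,\dots\}\cup\{\infty\}$ the view of the adversary is $$\mathcal O^{(t_{\max})}=\bigl(\{S_j\}_{j\in\mathcal V_c},\ \{Z^{(0)}_{j|k}\}_{(j,k)\in\mathcal E_c},\ \{\Delta\hat Z^{(t)}_{j|k}\}_{(j,k)\in\mathcal E,\ 1\le t\le t_{\max}}\bigr).$$ **Theorem.** Assume that every honest node has at least one corrupt neighbour. Let $i\in\mathcal V_h$, and let $\mathcal V_{h,1}$ be the vertex set of the connected component of $i$ in $(\mathcal V_h,\mathcal E_h)$. Put $$U_{\sigma_z^2}=\mathrm I\Bigl(S_i;\ \bigl\{S_j-\textstyle\sum_{k\in\mathcal N_{j,h}}B_{j|k}Z^{(0)}_{j|k}\bigr\}_{j\in\mathcal V_{h,1}},\ \bigl\{Z^{(0)}_{j|k}-Z^{(0)}_{k|j}\bigr\}_{j,k\in\mathcal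 V_{h,1},\,(j,k)\in\mathcal E}\Bigr),\qquad L=\mathrm I\Bigl(S_i;\textstyle\sum_{j\in\mathcal V_{h,1}}S_j\Bigr).$$ 1. $\mathrm I(S_i;\mathcal O^{(t_{\max})})\le U_{\sigma_z^2}$ for all $\sigma_z^2>0$, all $t_{\max}\le\infty$ and all $l\le\infty$. 2. If $S_j$ has finite variance for every $j\in\mathcal V_{h,1}$, then $\lim_{\sigma_z^2\to\infty}U_{\sigma_z^2}=L$, and $\limsup_{\sigma_z^2\to\infty}\mathrm I(S_i;\mathcal O^{(t_{\max})})\le L$ for all $t_{\max}\le\infty$ and all $l\le\infty$. 3. If the quantizer is overload-free, then $\liminf_{t_{\max}\to\infty}\mathrm I(S_i;\mathcal O^{(t_{\max})})\ge L$ and $\mathrm I(S_i;\mathcal O^{(\infty)})\ge L$, for all $\sigma_z^2>0$. 4. With the view $\mathcal O_{\mathrm{reideal}}=\bigl(\{S_j\}_{j\in\mathcal V_c},\{\sum_{j\in\mathcal V_{h,k}}S_j\}_{k=1,\dots,k_h}\bigr)$ of the redefined ideal world, $\mathcal V_{h,1},\dots,\mathcal V_{h,k_h}$ being the vertex sets of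 all the components of $(\mathcal V_h,\mathcal E_h)$, one has $\mathrm I(S_i;\mathcal O_{\mathrm{reideal}})=L$. If the quantizer is overload-free and the $S_j$, $j\in\mathcal V_{h,1}$, have finite variance, then $\lim_{\sigma_z^2\to\infty}\mathrm I(S_i;\mathcal O^{(\infty)})=\mathrm I(S_i;\mathcal O_{\mathrm{reideal}})$. -/

import Mathlib

open MeasureTheory ProbabilityTheory Filter Topology
open scoped NNReal ENNReal

/-- Mutual information `I(X;Y)` (in nats), as the Kullback-Leibler divergence of the joint law from
the product of the marginal laws. -/
noncomputable def mutualInfo {Ω α β : Type*} [MeasurableSpace Ω] [MeasurableSpace α]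
    [MeasurableSpace β] (P : Measure Ω) (X : Ω → α) (Y : Ω → β) : ℝ≥0∞ :=
  InformationTheory.klDiv (P.map fun ω => (X ω, Y ω)) ((P.map X).prod (P.map Y))

namespace ADQSP

/-- Numerical parameters of the protocol. `bits` is the number `l` of bits of the quantizer;
`bits = ⊤` is the quantizer that cannot overload. -/
structure Params where
  c : ℝ
  θ : ℝ
  γ : ℝ
  Δ₀ : ℝ
  Δmin : ℝ
  bits : ℕ∞

/-- The admissible parameters. -/
structure Params.Valid (p : Params) : Prop where
  c_pos : 0 < p.c
  θ_nonneg : 0 ≤ p.θ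
  θ_lt_one : p.θ < 1
  γ_pos : 0 < p.γ
  γ_lt_one : p.γ < 1
  Δ₀_pos : 0 < p.Δ₀
  Δmin_nonneg : 0 ≤ p.Δmin
  one_le_bits : 1 ≤ p.bits

/-- The cell width `Δ^(t) = max {γ^t Δ^(0), Δ_min}`. -/
noncomputable def Params.cellWidth (p : Params) (t : ℕ) : ℝ :=
  max (p.γ ^ t * p.Δ₀) p.Δmin

/-- Restriction of a cell index to the `l`-bit alphabet `{-2^(l-1), …, 2^(l-1) - 1}`; no restriction
for `l = ⊤`. -/
def clampIndex : ℕ∞ → ℤ → ℤ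
  | ⊤, a => a
  | (l : ℕ), a => max (-2 ^ (l - 1)) (min a (2 ^ (l - 1) - 1))

/-- The uniform mid-rise quantizer `Q^(t)`: it sends `x` to a nearest point of
`{Δ^(t) (a + 1/2)}`, with `a` in the alphabet. -/
noncomputable def Params.quantize (p : Params) (t : ℕ) (x : ℝ) : ℝ :=
  p.cellWidth t * ((clampIndex p.bits ⌊x / p.cellWidth t⌋ : ℤ) + 1 / 2)

/-- Quantization with (subtractive) dither `d`. -/
noncomputable def Params.ditheredQuantize (p : Params) (t : ℕ) (d x : ℝ) : ℝ :=
  p.quantize t (x + d) - d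

variable {V : Type*} [Fintype V] [LinearOrder V] (G : SimpleGraph V) [DecidableRel G.Adj]

/-- The signed weight `B_{i|j}` of the dart `(i, j)`: `1` if `i < j`, and `-1` if `j < i`. -/
def weight {G : SimpleGraph V} (e : G.Dart) : ℝ := if e.fst < e.snd then 1 else -1

/-- The `x`-update of node `i`. The value `z_{i|j}`, held by node `i`, is `z e` at the dart
`e = (i, j)`. -/
noncomputable def xUpdate (p : Params) (s : V → ℝ) (z : G.Dart → ℝ) (i : V) : ℝ :=
  (s i - ∑ e : G.Dart with e.fst = i, weight e * z e) / (1 + p.c * G.degree i)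

/-- The `z`-update: for the dart `e = (j, i)` this is
`θ z_{j|i} + (1 - θ) (z_{i|j} + 2 c B_{i|j} x_i)`, with `x_i` the `x`-update of `z`. -/
noncomputable def zUpdate (p : Params) (s : V → ℝ) (z : G.Dart → ℝ) (e : G.Dart) : ℝ :=
  p.θ * z e + (1 - p.θ) * (z e.symm + 2 * p.c * weight e.symm * xUpdate G p s z e.snd)

/-- The transmitted increment `Δẑ^(t+1) = Q^(t+1)(z^(t+1) - ẑ^(t))`, as a function of `ẑ^(t)` and of
the dithers `d` (`d (t, e)` being used at iteration `t` on the dart `e`). -/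
noncomputable def increment (p : Params) (s : V → ℝ) (d : ℕ × G.Dart → ℝ) (t : ℕ)
    (zh : G.Dart → ℝ) (e : G.Dart) : ℝ :=
  p.ditheredQuantize (t + 1) (d (t + 1, e)) (zUpdate G p s zh e - zh e)

/-- The quantized auxiliary variable `ẑ^(t)`, with `ẑ^(0) = z^(0)`. -/
noncomputable def zHat (p : Params) (s : V → ℝ) (z₀ : G.Dart → ℝ) (d : ℕ × G.Dart → ℝ) :
    ℕ → G.Dart → ℝ
  | 0 => z₀
  | t + 1 => fun e => zHat p s z₀ d t e + increment G p s d t (zHat p s z₀ d t) e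

/-- The message `Δẑ^(t+1)_e`, for `t ≥ 0`. -/
noncomputable def message (p : Params) (s : V → ℝ) (z₀ : G.Dart → ℝ) (d : ℕ × G.Dart → ℝ)
    (t : ℕ) (e : G.Dart) : ℝ :=
  increment G p s d t (zHat G p s z₀ d t) e

variable {Ω : Type*} (H : Set V)

/-- The view of the adversary, the set of honest nodes being `H`, in a run of `T` iterations
(`T = ⊤`: infinitely many): the private data of the corrupt nodes, the initial values
`z^(0)_{j|k}` on the edges with a corrupt end, and the messages `Δẑ^(1), …, Δẑ^(T)` on all edges. -/
noncomputable def view (p : Params) (S : V → Ω → ℝ) (Z : G.Dart → Ω → ℝ)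
    (D : ℕ × G.Dart → Ω → ℝ) (T : ℕ∞) (ω : Ω) :
    ({j : V // j ∉ H} → ℝ) × ({e : G.Dart // ¬(e.fst ∈ H ∧ e.snd ∈ H)} → ℝ) ×
      ({t : ℕ // (t : ℕ∞) < T} × G.Dart → ℝ) :=
  (fun j => S j ω, fun e => Z e ω,
    fun te => message G p (S · ω) (Z · ω) (D · ω) te.1 te.2)

/-- The vertex set of the connected component of the honest node `i` in the subgraph induced on the
set `H` of honest nodes. -/
def honestComponent (i : V) : Set V :=
  {j | ∃ (hi : i ∈ H) (hj : j ∈ H), (G.induce H).Reachable ⟨i, hi⟩ ⟨j, hj⟩}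

open scoped Classical in
/-- The sum of the private data over the honest component of `i`. -/
noncomputable def componentSum (i : V) (S : V → Ω → ℝ) (ω : Ω) : ℝ :=
  ∑ j : V with j ∈ honestComponent G H i, S j ω

open scoped Classical in
/-- The component-local perturbed quantities: `S_j - ∑_k B_{j|k} Z_{j|k}` (with `k` running over the
honest neighbours of `j`) for `j` in the honest component of `i`, and `Z_{j|k} - Z_{k|j}` for the
adjacent `j`, `k` in this component. -/
noncomputable def perturbed (i : V) (S : V → Ω → ℝ) (Z : G.Dart → Ω → ℝ) (ω : Ω) :
    ({j : V // j ∈ honestComponent G H i} → ℝ) ×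
      ({e : G.Dart // e.fst ∈ honestComponent G H i ∧ e.snd ∈ honestComponent G H i} → ℝ) :=
  (fun j => S j ω - ∑ e : G.Dart with e.fst = (j : V) ∧ e.snd ∈ H, weight e * Z e ω,
    fun e => Z e ω - Z (e : G.Dart).symm ω)

open scoped Classical in
/-- The adversary's observation in the redefined ideal world: the private data of the corrupt nodes,
and the sum of the private data over each connected component of the honest subgraph. -/
noncomputable def idealView (S : V → Ω → ℝ) (ω : Ω) :
    ({j : V // j ∉ H} → ℝ) × ((G.induce H).ConnectedComponent → ℝ) :=
  (fun j => S j ω,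
    fun C => ∑ j : H with (G.induce H).connectedComponentMk j = C, S j ω)

/-- The randomness of the protocol: the private data `S`, the initial values `Z` and the dithers `D`
are mutually independent, the initial values are `N(0, v)`, and the dither of iteration `t` is
uniform on `[-Δ^(t)/2, Δ^(t)/2]`. -/
structure IsRandomness [MeasurableSpace Ω] (P : Measure Ω) (p : Params) (v : ℝ≥0)
    (S : V → Ω → ℝ) (Z : G.Dart → Ω → ℝ) (D : ℕ × G.Dart → Ω → ℝ) : Prop where
  measurable_S : ∀ j, Measurable (S j)
  measurable_Z : ∀ e, Measurable (Z e)
  measurable_D : ∀ te, Measurable (D te)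
  law_Z : ∀ e, P.map (Z e) = gaussianReal 0 v
  law_D : ∀ te : ℕ × G.Dart,
    pdf.IsUniform (D te) (Set.Icc (-(p.cellWidth te.1 / 2)) (p.cellWidth te.1 / 2)) P
  indep : iIndepFun (Sum.elim S (Sum.elim Z D)) P

end ADQSP

/-! The protocol has a gauge symmetry. Add a symmetric function `h` of the darts to the initial
values and compensate each private value by the signed sum of `h` over the darts leaving its node.
Then `x` and every increment `z - ẑ` stay the same, hence so do all messages, whatever the quantizer
(`message_gauge`).

Upper bound: inside the component of `i`, choose the gauge that makes the initial value at the
larger end of each edge vanish. The gauged data are functions of the perturbed quantities, so the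
view is a function of these and of variables outside the component, which are independent of them
and of the secret (`view_eq_view_gauged`, `mutualInfo_le_of_mask`).

Large noise: a second gauge routes all private data of the component to `i` by flows along honest
walks. The perturbed quantities become a function of the component sum and of noisy values `F e + Z
e`, with `F e` linear in the private data. A Gaussian mask of variance `v` lets through at most `E
(F e)² / (2v)` per dart (`mutualInfo_prodMk_add_gaussian_le`), so the excess over `L` is `O(1/v)`.
Conversely, the component sum is a linear function of the perturbed quantities.

Lower bound: without overload, the quantization error is at most half a cell width and tends to `0`.
Each honest node has an edge to a corrupt one, on which the adversary can replay `ẑ` and solve for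
`x_j` up to this error. The messages on honest edges then give the differences of `ẑ` across them,
which is all that the component sum requires. The estimate converges for every outcome
(`tendsto_sumEstimate`), and lower semicontinuity of the relative entropy (`klDiv_le_liminf`)
carries this to mutual information. Convergence of the iteration itself is not needed. -/

/-! ### Mutual information: data processing, independent observations, Gaussian masking -/

section MutualInformation

open InformationTheory

variable {Ω α β γ : Type*} [MeasurableSpace Ω] [MeasurableSpace α] [MeasurableSpace β]
  [MeasurableSpace γ] {P : Measure Ω} [IsProbabilityMeasure P]

/-- Data processing inequality for the mutual information. -/
theorem mutualInfo_comp_le {X : Ω → α} {Y : Ω → β} {g : β → γ} (hX : Measurable X)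
    (hY : Measurable Y) (hg : Measurable g) :
    mutualInfo P X (fun ω => g (Y ω)) ≤ mutualInfo P X Y := by
  have := Measure.isProbabilityMeasure_map (μ := P) hX.aemeasurable
  have := Measure.isProbabilityMeasure_map (μ := P) hY.aemeasurable
  have h := klDiv_map_le (P.map fun ω => (X ω, Y ω)) ((P.map X).prod (P.map Y))
    (g := Prod.map id g) (by fun_prop)
  rw [Measure.map_map (by fun_prop) (by fun_prop), ← Measure.map_prod_map _ _ measurable_id hg,
    Measure.map_id, Measure.map_map hg hY] at h
  exact h

/-- An observation which is independent of everything else carries no information. -/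
theorem mutualInfo_prodMk_le_of_indepFun {X : Ω → α} {Y : Ω → β} {W : Ω → γ} (hX : Measurable X)
    (hY : Measurable Y) (hW : Measurable W) (h : IndepFun (fun ω => (X ω, Y ω)) W P) :
    mutualInfo P X (fun ω => (Y ω, W ω)) ≤ mutualInfo P X Y := by
  have := Measure.isProbabilityMeasure_map (μ := P) hX.aemeasurable
  have := Measure.isProbabilityMeasure_map (μ := P) hY.aemeasurable
  have := Measure.isProbabilityMeasure_map (μ := P) hW.aemeasurable
  have := Measure.isProbabilityMeasure_map (μ := P) (hX.prodMk hY).aemeasurable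
  have hXY := h.map_prod_eq_prod_map_map (by fun_prop) (by fun_prop)
  have hYW := (h.comp measurable_snd measurable_id).map_prod_eq_prod_map_map
    (by fun_prop) (by fun_prop)
  -- Appending the same independent coordinate to both measures leaves their divergence unchanged.
  have key := klDiv_compProd_left (P.map fun ω => (X ω, Y ω)) ((P.map X).prod (P.map Y))
    (Kernel.const _ (P.map W))
  rw [Measure.compProd_const, Measure.compProd_const] at key
  have hle := klDiv_map_le ((P.map fun ω => (X ω, Y ω)).prod (P.map W))
    (((P.map X).prod (P.map Y)).prod (P.map W)) (g := MeasurableEquiv.prodAssoc)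
    MeasurableEquiv.prodAssoc.measurable
  rw [key] at hle
  refine le_trans (le_of_eq ?_) hle
  unfold mutualInfo
  congr 1
  · rw [← hXY, Measure.map_map MeasurableEquiv.prodAssoc.measurable (by fun_prop)]
    rfl
  · have : P.map (fun ω => (Y ω, W ω)) = (P.map Y).prod (P.map W) := hYW
    rw [this]
    exact (Measure.prodAssoc_prod).symm

/-- The product of the marginal laws is the closest to the joint law among the products of the first
marginal with a probability measure. -/
theorem mutualInfo_le_klDiv_prod [StandardBorelSpace α] [Nonempty α] {X : Ω → α} {Y : Ω → β}
    (hX : Measurable X) (hY : Measurable Y) (Q : Measure β) [IsProbabilityMeasure Q] :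
    mutualInfo P X Y ≤ klDiv (P.map fun ω => (X ω, Y ω)) ((P.map X).prod Q) := by
  have := Measure.isProbabilityMeasure_map (μ := P) hX.aemeasurable
  have := Measure.isProbabilityMeasure_map (μ := P) hY.aemeasurable
  have := Measure.isProbabilityMeasure_map (μ := P) (hX.prodMk hY).aemeasurable
  -- Chain rule: the divergence from `Q × P_X` is the one from `P_Y × P_X` plus `klDiv P_Y Q`, which
  -- is dropped at the end.
  have h := klDiv_compProd_eq_add (P.map Y) Q (condDistrib X Y P) (Kernel.const _ (P.map X))
  rw [compProd_map_condDistrib hX.aemeasurable, Measure.compProd_const, Measure.compProd_const] at h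
  have h1 : mutualInfo P X Y ≤ klDiv (P.map fun ω => (Y ω, X ω)) ((P.map Y).prod (P.map X)) := by
    have := klDiv_map_le (P.map fun ω => (Y ω, X ω)) ((P.map Y).prod (P.map X))
      measurable_swap
    rw [Measure.map_map measurable_swap (by fun_prop), Measure.prod_swap] at this
    exact this
  have h2 : klDiv (P.map fun ω => (Y ω, X ω)) (Q.prod (P.map X)) ≤
      klDiv (P.map fun ω => (X ω, Y ω)) ((P.map X).prod Q) := by
    have := klDiv_map_le (P.map fun ω => (X ω, Y ω)) ((P.map X).prod Q) measurable_swap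
    rw [Measure.map_map measurable_swap (by fun_prop), Measure.prod_swap] at this
    exact this
  refine h1.trans (le_trans ?_ h2)
  rw [h]
  exact le_add_self

/-- The joint law of `W` and of a centred Gaussian variable shifted by `φ W`, as a density. -/
theorem map_prod_shift_gaussianReal (m : Measure γ) [IsProbabilityMeasure m] {v : ℝ≥0} (hv : v ≠ 0)
    {φ : γ → ℝ} (hφ : Measurable φ) :
    (m.prod (gaussianReal 0 v)).map (fun x => (x.1, φ x.1 + x.2)) =
      (m.prod (gaussianReal 0 v)).withDensity fun x =>
        ENNReal.ofReal (Real.exp ((2 * φ x.1 * x.2 - φ x.1 ^ 2) / (2 * v))) := by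
  have hv' : (v : ℝ) ≠ 0 := by exact_mod_cast hv
  have hg : Measurable fun x : γ × ℝ =>
      ENNReal.ofReal (Real.exp ((2 * φ x.1 * x.2 - φ x.1 ^ 2) / (2 * v))) := by fun_prop
  refine Measure.ext_of_lintegral _ fun f hf => ?_
  rw [lintegral_map hf (by fun_prop), lintegral_prod _ (by fun_prop),
    lintegral_withDensity_eq_lintegral_mul _ hg hf, lintegral_prod _ (by fun_prop)]
  refine lintegral_congr fun w => ?_
  have h1 : ∫⁻ n, f (w, φ w + n) ∂gaussianReal 0 v = ∫⁻ b, f (w, b) ∂gaussianReal (φ w) v := by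
    have h2 := gaussianReal_map_const_add (μ := 0) (v := v) (φ w)
    rw [zero_add] at h2
    rw [← h2, lintegral_map (by fun_prop) (by fun_prop)]
  simp only [Pi.mul_apply]
  rw [h1, gaussianReal_of_var_ne_zero _ hv, gaussianReal_of_var_ne_zero _ hv,
    lintegral_withDensity_eq_lintegral_mul _ (measurable_gaussianPDF _ _) (by fun_prop),
    lintegral_withDensity_eq_lintegral_mul _ (measurable_gaussianPDF _ _) (by fun_prop)]
  refine lintegral_congr fun b => ?_
  simp only [Pi.mul_apply]
  rw [← mul_assoc]
  congr 1
  rw [gaussianPDF, gaussianPDF, ← ENNReal.ofReal_mul (gaussianPDFReal_nonneg _ _ _)]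
  congr 1
  simp only [gaussianPDFReal]
  rw [mul_assoc _ (Real.exp _) (Real.exp _), ← Real.exp_add]
  congr 2
  field_simp
  ring

/-- Relative entropy of a shifted Gaussian variable with respect to the unshifted one. -/
theorem klDiv_shift_gaussianReal_le {v : ℝ≥0} (hv : v ≠ 0) {W : Ω → γ} {N : Ω → ℝ} {φ : γ → ℝ}
    (hW : Measurable W) (hN : Measurable N) (hφ : Measurable φ)
    (hlaw : P.map N = gaussianReal 0 v) (hind : IndepFun W N P)
    (hL : MemLp (fun ω => φ (W ω)) 2 P) :
    klDiv (P.map fun ω => (W ω, φ (W ω) + N ω)) ((P.map W).prod (gaussianReal 0 v)) ≤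
      ENNReal.ofReal ((∫ ω, φ (W ω) ^ 2 ∂P) / (2 * v)) := by
  have := Measure.isProbabilityMeasure_map (μ := P) hW.aemeasurable
  have hjoint := hind.map_prod_eq_prod_map_map hW.aemeasurable hN.aemeasurable
  rw [hlaw] at hjoint
  set R := (P.map W).prod (gaussianReal 0 v) with hR
  set g : γ × ℝ → ℝ := fun x => (2 * φ x.1 * x.2 - φ x.1 ^ 2) / (2 * v) with hg
  have hgm : Measurable g := by fun_prop
  have hJ : (P.map fun ω => (W ω, φ (W ω) + N ω)) =
      R.withDensity fun x => ENNReal.ofReal (Real.exp (g x)) := by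
    rw [hR, ← map_prod_shift_gaussianReal _ hv hφ, ← hR, ← hjoint, Measure.map_map (by fun_prop)
      (by fun_prop)]
    rfl
  set J := P.map fun ω => (W ω, φ (W ω) + N ω) with hJdef
  have : IsProbabilityMeasure J := Measure.isProbabilityMeasure_map (by fun_prop)
  have hac : J ≪ R := hJ ▸ withDensity_absolutelyContinuous _ _
  have hllr : llr J R =ᵐ[J] g := by
    have h1 : J.rnDeriv R =ᵐ[R] fun x => ENNReal.ofReal (Real.exp (g x)) := by
      rw [hJ]; exact Measure.rnDeriv_withDensity _ (by fun_prop)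
    filter_upwards [hac.ae_le h1] with x hx
    rw [llr, hx, ENNReal.toReal_ofReal (Real.exp_pos _).le, Real.log_exp]
  have hNL : MemLp N 2 P := by
    have h := memLp_id_gaussianReal (μ := 0) (v := v) 2
    rw [← hlaw] at h
    exact (memLp_map_measure_iff aestronglyMeasurable_id hN.aemeasurable).1 h
  have hsq := hL.integrable_sq
  have hmul : Integrable (fun ω => φ (W ω) * N ω) P := hL.integrable_mul hNL
  -- Along the shifted variable the log-likelihood ratio is a quadratic term, which gives the bound,
  -- plus a cross term that has mean zero by independence.
  have hgJ : ∀ ω, g (W ω, φ (W ω) + N ω) = (2 * v : ℝ)⁻¹ * φ (W ω) ^ 2 +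
      (v : ℝ)⁻¹ * (φ (W ω) * N ω) := by
    intro ω
    have hv' : (v : ℝ) ≠ 0 := by exact_mod_cast hv
    simp only [hg]
    field_simp
    ring
  have hint : Integrable g J := by
    rw [hJdef, integrable_map_measure (by fun_prop) (by fun_prop)]
    refine ((hsq.const_mul _).add (hmul.const_mul _)).congr (ae_of_all _ fun ω => (hgJ ω).symm)
  have hzero : ∫ ω, φ (W ω) * N ω ∂P = 0 := by
    have h := (hind.comp hφ measurable_id).integral_mul_eq_mul_integral
      (hφ.comp hW).aestronglyMeasurable hN.aestronglyMeasurable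
    have hN0 : ∫ ω, N ω ∂P = 0 := by
      have h2 := integral_id_gaussianReal (μ := 0) (v := v)
      rw [← hlaw, integral_map hN.aemeasurable (by fun_prop)] at h2
      exact h2
    calc _ = _ := h
      _ = 0 := by simp [hN0]
  rw [klDiv_of_ac_of_integrable hac (hint.congr hllr.symm), integral_congr_ae hllr, hJdef,
    integral_map (by fun_prop) (by fun_prop)]
  refine ENNReal.ofReal_le_ofReal ?_
  simp_rw [hgJ]
  rw [integral_add (hsq.const_mul _) (hmul.const_mul _), integral_const_mul, integral_const_mul,
    hzero]
  simp [div_eq_inv_mul]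

/-- Observing a square-integrable variable through independent Gaussian noise of variance `v`
increases the mutual information by at most the signal-to-noise ratio over two. -/
theorem mutualInfo_prodMk_add_gaussian_le [StandardBorelSpace α] [Nonempty α] {v : ℝ≥0}
    (hv : v ≠ 0) {X : Ω → α} {A : Ω → β} {F N : Ω → ℝ} (hX : Measurable X) (hA : Measurable A)
    (hF : Measurable F) (hN : Measurable N) (hlaw : P.map N = gaussianReal 0 v)
    (hind : IndepFun (fun ω => (X ω, A ω, F ω)) N P) (hL : MemLp F 2 P) :
    mutualInfo P X (fun ω => (A ω, F ω + N ω)) ≤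
      mutualInfo P X A + ENNReal.ofReal ((∫ ω, F ω ^ 2 ∂P) / (2 * v)) := by
  have := Measure.isProbabilityMeasure_map (μ := P) hX.aemeasurable
  have := Measure.isProbabilityMeasure_map (μ := P) hA.aemeasurable
  have := Measure.isProbabilityMeasure_map (μ := P) (hX.prodMk hA).aemeasurable
  have := Measure.isProbabilityMeasure_map (μ := P) (hX.prodMk (hA.prodMk hF)).aemeasurable
  set q := gaussianReal 0 v
  set B : Ω → ℝ := fun ω => F ω + N ω with hB
  have hBm : Measurable B := by fun_prop
  -- The unknown law of `(A, B)` is replaced by `P_A × q`; against this product reference the chain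
  -- rule splits off `I(X; A)`.
  have h1 := mutualInfo_le_klDiv_prod (P := P) hX (hA.prodMk hBm) ((P.map A).prod q)
  have h2 : klDiv (P.map fun ω => (X ω, (A ω, B ω))) ((P.map X).prod ((P.map A).prod q)) ≤
      klDiv (P.map fun ω => ((X ω, A ω), B ω)) (((P.map X).prod (P.map A)).prod q) := by
    have := klDiv_map_le (P.map fun ω => ((X ω, A ω), B ω)) (((P.map X).prod (P.map A)).prod q)
      (g := MeasurableEquiv.prodAssoc) MeasurableEquiv.prodAssoc.measurable
    rw [Measure.prodAssoc_prod, Measure.map_map MeasurableEquiv.prodAssoc.measurable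
      (by fun_prop)] at this
    exact this
  have h3 := klDiv_compProd_eq_add (P.map fun ω => (X ω, A ω)) ((P.map X).prod (P.map A))
    (condDistrib B (fun ω => (X ω, A ω)) P) (Kernel.const _ q)
  rw [compProd_map_condDistrib hBm.aemeasurable, Measure.compProd_const, Measure.compProd_const]
    at h3
  have h4 := klDiv_shift_gaussianReal_le (φ := fun x : α × β × ℝ => x.2.2) hv
    (hX.prodMk (hA.prodMk hF)) hN (by fun_prop) hlaw hind hL
  -- Forgetting `F` can only decrease the divergence; with `F` retained, the last coordinate is an
  -- explicit Gaussian shift.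
  have h5 : klDiv (P.map fun ω => ((X ω, A ω), B ω)) ((P.map fun ω => (X ω, A ω)).prod q) ≤
      klDiv (P.map fun ω => ((X ω, A ω, F ω), F ω + N ω))
        ((P.map fun ω => (X ω, A ω, F ω)).prod q) := by
    have := klDiv_map_le (P.map fun ω => ((X ω, A ω, F ω), F ω + N ω))
        ((P.map fun ω => (X ω, A ω, F ω)).prod q)
        (g := Prod.map (fun x : α × β × ℝ => (x.1, x.2.1)) id) (by fun_prop)
    rw [← Measure.map_prod_map _ _ (by fun_prop) measurable_id, Measure.map_map (by fun_prop)
      (by fun_prop), Measure.map_map (by fun_prop) (by fun_prop), Measure.map_id] at this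
    exact this
  calc _ ≤ _ := h1
    _ ≤ _ := h2
    _ = _ := h3
    _ ≤ _ := by
      unfold mutualInfo
      gcongr
      exact h5.trans h4

end MutualInformation

/-! ### Variational formula and lower semicontinuity of the relative entropy -/

section Semicontinuity

open InformationTheory

variable {E : Type*} [MeasurableSpace E]

/-- Young's inequality for the convex conjugate pair `klFun` and `exp - 1`. -/
theorem mul_sub_exp_sub_one_le_klFun (y : ℝ) {r : ℝ} (hr : 0 ≤ r) :
    y * r - (Real.exp y - 1) ≤ klFun r := by
  rcases hr.eq_or_lt with rfl | hr
  · simp [klFun_zero, (Real.exp_pos y).le]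
  · have h := Real.add_one_le_exp (y - Real.log r)
    rw [Real.exp_sub, Real.exp_log hr, le_div_iff₀ hr] at h
    rw [klFun_apply]
    nlinarith

/-- If `r` lies in `[a, b]` this is `klFun r`. Outside, moving `r` to the nearer endpoint can only
decrease the first term, because `log a ≤ 0 ≤ log b`. The sign is what allows Fatou's lemma below.
-/
theorem klFun_clip_nonneg {r a b : ℝ} (hr : 0 ≤ r) (ha : 0 < a) (ha1 : a ≤ 1) (hb : 1 ≤ b) :
    0 ≤ Real.log (max a (min r b)) * r - (max a (min r b) - 1) := by
  have key : ∀ y : ℝ, 0 < y → 0 ≤ Real.log y * y - (y - 1) := fun y hy => by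
    have := klFun_nonneg hy.le
    rw [klFun_apply] at this
    linarith
  rcases le_total r a with h | h
  · rw [min_eq_left (by linarith), max_eq_left h]
    have h1 := key a ha
    have h2 := Real.log_nonpos ha.le ha1
    nlinarith
  rcases le_total r b with h' | h'
  · rw [min_eq_left h', max_eq_right h]
    exact key r (by linarith)
  · rw [min_eq_right h', max_eq_right (by linarith)]
    have h1 := key b (by linarith)
    have h2 := Real.log_nonneg hb
    nlinarith

/-- The functional in the variational formula for the relative entropy. -/
noncomputable def klDual (μ ν : Measure E) (f : E → ℝ) : ℝ :=
  ∫ x, f x ∂μ - ∫ x, (Real.exp (f x) - 1) ∂ν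

theorem integrable_of_abs_le {μ : Measure E} [IsFiniteMeasure μ] {f : E → ℝ} (hf : Measurable f)
    {C : ℝ} (hC : ∀ x, |f x| ≤ C) : Integrable f μ :=
  .of_bound hf.aestronglyMeasurable C (ae_of_all _ hC)

theorem integrable_exp_sub_one {μ : Measure E} [IsFiniteMeasure μ] {f : E → ℝ} (hf : Measurable f)
    {C : ℝ} (hC : ∀ x, |f x| ≤ C) : Integrable (fun x => Real.exp (f x) - 1) μ := by
  refine (Integrable.of_bound (C := Real.exp C) (by fun_prop) (ae_of_all _ fun x => ?_)).sub
    (integrable_const 1)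
  rw [Real.norm_eq_abs, Real.abs_exp]
  exact Real.exp_le_exp.2 ((le_abs_self _).trans (hC x))

theorem klDual_eq_integral {μ ν : Measure E} [IsFiniteMeasure μ] [IsFiniteMeasure ν] (h : μ ≪ ν)
    {f : E → ℝ} (hf : Measurable f) {C : ℝ} (hC : ∀ x, |f x| ≤ C) :
    Integrable (fun x => f x * (μ.rnDeriv ν x).toReal - (Real.exp (f x) - 1)) ν ∧
      klDual μ ν f = ∫ x, (f x * (μ.rnDeriv ν x).toReal - (Real.exp (f x) - 1)) ∂ν := by
  have h1 : Integrable (fun x => f x * (μ.rnDeriv ν x).toReal) ν :=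
    Integrable.bdd_mul Measure.integrable_toReal_rnDeriv hf.aestronglyMeasurable
      (ae_of_all _ hC)
  refine ⟨h1.sub (integrable_exp_sub_one hf hC), ?_⟩
  rw [integral_sub h1 (integrable_exp_sub_one hf hC), klDual,
    ← integral_rnDeriv_smul h]
  simp_rw [smul_eq_mul, mul_comm]

/-- Young's inequality, applied pointwise to the density and integrated. Only the positive part of
the integrand is kept, so `klFun` of the density need not be integrable. -/
theorem klDual_le_klDiv (μ ν : Measure E) [IsFiniteMeasure μ] [IsFiniteMeasure ν] {f : E → ℝ}
    (hf : Measurable f) {C : ℝ} (hC : ∀ x, |f x| ≤ C) :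
    ENNReal.ofReal (klDual μ ν f) ≤ klDiv μ ν := by
  by_cases h : μ ≪ ν
  swap; · simp [klDiv_of_not_ac h]
  obtain ⟨hi, he⟩ := klDual_eq_integral h hf hC
  rw [he, klDiv_eq_lintegral_klFun_of_ac h]
  rw [integral_eq_lintegral_pos_part_sub_lintegral_neg_part hi]
  refine (ENNReal.ofReal_le_ofReal (sub_le_self _ ENNReal.toReal_nonneg)).trans
    (ENNReal.ofReal_toReal_le.trans (lintegral_mono fun x => ENNReal.ofReal_le_ofReal ?_))
  exact mul_sub_exp_sub_one_le_klFun _ ENNReal.toReal_nonneg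

theorem abs_exp_sub_exp_le {a b C : ℝ} (ha : a ≤ C) (hb : b ≤ C) :
    |Real.exp a - Real.exp b| ≤ Real.exp C * |a - b| := by
  wlog h : b ≤ a generalizing a b
  · rw [abs_sub_comm, abs_sub_comm a]
    exact this hb ha (le_of_not_ge h)
  rw [abs_of_nonneg (sub_nonneg.2 (Real.exp_le_exp.2 h)), abs_of_nonneg (sub_nonneg.2 h)]
  have h1 := Real.add_one_le_exp (b - a)
  rw [Real.exp_sub, le_div_iff₀ (Real.exp_pos a)] at h1
  have h2 := mul_le_mul_of_nonneg_right (Real.exp_le_exp.2 ha) (sub_nonneg.2 h)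
  linarith

/-- The optimal test function is the logarithm of the density. It may be unbounded, so the density
is clipped to `[1/(n+1), n+1]` and Fatou's lemma recovers the divergence in the limit. Without
absolute continuity, a large multiple of the indicator of a `ν`-null set charged by `μ` does it. -/
theorem exists_measurable_lt_klDual (μ ν : Measure E) [IsFiniteMeasure μ] [IsFiniteMeasure ν]
    {c : ℝ≥0∞} (hc : c < klDiv μ ν) :
    ∃ (f : E → ℝ) (C : ℝ), Measurable f ∧ (∀ x, |f x| ≤ C) ∧
      c < ENNReal.ofReal (klDual μ ν f) := by
  by_cases h : μ ≪ ν
  · set r : E → ℝ := fun x => (μ.rnDeriv ν x).toReal with hr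
    have hrm : Measurable r := (Measure.measurable_rnDeriv μ ν).ennreal_toReal
    have hr0 : ∀ x, 0 ≤ r x := fun x => ENNReal.toReal_nonneg
    set k : ℕ → E → ℝ := fun n x => max ((n + 1 : ℝ)⁻¹) (min (r x) (n + 1)) with hk
    have hn1 : ∀ n : ℕ, (1 : ℝ) ≤ n + 1 := fun n => by simp
    have hkpos : ∀ n x, 0 < k n x := fun n x => lt_max_of_lt_left (by positivity)
    set f : ℕ → E → ℝ := fun n x => Real.log (k n x) with hf
    have hfm : ∀ n, Measurable (f n) := fun n => by fun_prop
    have hfC : ∀ n x, |f n x| ≤ Real.log (n + 1) := by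
      intro n x
      have hpos : (0 : ℝ) < n + 1 := by positivity
      rw [abs_le, ← Real.log_inv]
      refine ⟨Real.log_le_log (by positivity) (le_max_left _ _), Real.log_le_log (hkpos n x) ?_⟩
      exact max_le ((inv_le_one_of_one_le₀ (hn1 n)).trans (hn1 n)) (min_le_right _ _)
    set ψ : ℕ → E → ℝ := fun n x => f n x * r x - (Real.exp (f n x) - 1) with hψ
    have hψ0 : ∀ n x, 0 ≤ ψ n x := by
      intro n x
      simp only [hψ, hf, Real.exp_log (hkpos n x)]
      exact klFun_clip_nonneg (hr0 x) (by positivity) (inv_le_one_of_one_le₀ (hn1 n)) (hn1 n)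
    have hlim : ∀ x, Tendsto (fun n => ψ n x) atTop (𝓝 (klFun (r x))) := by
      intro x
      have hinv : Tendsto (fun n : ℕ => ((n : ℝ) + 1)⁻¹) atTop (𝓝 0) := by
        simpa using tendsto_one_div_add_atTop_nhds_zero_nat (𝕜 := ℝ)
      rcases (hr0 x).eq_or_lt with h0 | h0
      · have : ∀ n, ψ n x = 1 - ((n : ℝ) + 1)⁻¹ := by
          intro n
          have h1 : k n x = ((n : ℝ) + 1)⁻¹ := by
            simp only [hk, ← h0]
            rw [min_eq_left (by positivity), max_eq_left (by positivity)]
          simp only [hψ, hf, Real.exp_log (hkpos n x)]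
          rw [h1, ← h0]
          ring
        simp_rw [this, ← h0, klFun_zero]
        simpa using hinv.const_sub 1
      · refine tendsto_const_nhds.congr' ?_
        have h1 : ∀ᶠ n : ℕ in atTop, ((n : ℝ) + 1)⁻¹ ≤ r x := hinv.eventually_le_const h0
        have h2 : ∀ᶠ n : ℕ in atTop, r x ≤ (n : ℝ) + 1 := by
          filter_upwards [eventually_ge_atTop ⌈r x⌉₊] with n hn
          have := (Nat.le_ceil (r x)).trans (Nat.cast_le.2 hn)
          linarith
        filter_upwards [h1, h2] with n hn1 hn2
        have h3 : k n x = r x := by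
          simp only [hk]
          rw [min_eq_left hn2, max_eq_right hn1]
        simp only [hψ, hf, Real.exp_log (hkpos n x), klFun_apply]
        rw [h3]
        ring
    have hfatou : klDiv μ ν ≤ liminf (fun n => ENNReal.ofReal (klDual μ ν (f n))) atTop := by
      have h1 : ∀ n, ENNReal.ofReal (klDual μ ν (f n)) = ∫⁻ x, ENNReal.ofReal (ψ n x) ∂ν := by
        intro n
        obtain ⟨hi, he⟩ := klDual_eq_integral h (hfm n) (hfC n)
        rw [he, ofReal_integral_eq_lintegral_ofReal hi (ae_of_all _ (hψ0 n))]
      simp_rw [h1]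
      refine le_trans (le_of_eq ?_) (lintegral_liminf_le fun n => by fun_prop)
      rw [klDiv_eq_lintegral_klFun_of_ac h]
      refine lintegral_congr fun x => ?_
      exact (((ENNReal.continuous_ofReal.tendsto _).comp (hlim x)).liminf_eq).symm
    obtain ⟨n, hn⟩ := (eventually_lt_of_lt_liminf (hc.trans_le hfatou)).exists
    exact ⟨f n, _, hfm n, hfC n, hn⟩
  · obtain ⟨A, hA, hνA, hμA⟩ : ∃ A, MeasurableSet A ∧ ν A = 0 ∧ μ A ≠ 0 := by
      by_contra! hcon
      exact h (Measure.AbsolutelyContinuous.mk hcon)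
    have hct : c ≠ ∞ := (hc.trans_le le_top).ne
    have hpos : 0 < μ.real A := ENNReal.toReal_pos hμA (measure_ne_top _ _)
    -- With this `M` the functional takes the value `c + 1`.
    set M := (c.toReal + 1) / μ.real A with hM
    have hM0 : 0 ≤ M := by positivity
    refine ⟨A.indicator fun _ => M, M, measurable_const.indicator hA, fun x => ?_, ?_⟩
    · by_cases hx : x ∈ A <;> simp [hx, abs_of_nonneg hM0, hM0]
    · have h1 : ∫ x, (Real.exp (A.indicator (fun _ => M) x) - 1) ∂ν = 0 := by
        refine integral_eq_zero_of_ae ?_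
        filter_upwards [measure_eq_zero_iff_ae_notMem.1 hνA] with x hx
        simp [hx]
      rw [klDual, h1, integral_indicator_const _ hA, sub_zero, smul_eq_mul, hM,
        mul_div_cancel₀ _ hpos.ne', ENNReal.lt_ofReal_iff_toReal_lt hct]
      linarith

/-- Bounded continuous functions are dense in `L¹(μ + ν)`. Clipping the approximation to `[-C, C]`
does not increase its distance to `f`, and there `exp` is Lipschitz with constant `exp C`, so both
terms of the functional are controlled. -/
theorem exists_continuous_lt_klDual [TopologicalSpace E] [TopologicalSpace.PseudoMetrizableSpace E]
    [BorelSpace E] (μ ν : Measure E) [IsFiniteMeasure μ]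
    [IsFiniteMeasure ν] {c : ℝ≥0∞} (hc : c < klDiv μ ν) :
    ∃ (f : E → ℝ) (C : ℝ), Continuous f ∧ (∀ x, |f x| ≤ C) ∧
      c < ENNReal.ofReal (klDual μ ν f) := by
  obtain ⟨f, C, hf, hC, hlt⟩ := exists_measurable_lt_klDual μ ν hc
  have hct : c ≠ ∞ := (hc.trans_le le_top).ne
  rw [ENNReal.lt_ofReal_iff_toReal_lt hct] at hlt
  set δ := klDual μ ν f - c.toReal with hδ
  have hδ0 : 0 < δ := by linarith
  rcases isEmpty_or_nonempty E with hE | ⟨⟨x₀⟩⟩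
  · exact ⟨f, C, continuous_of_const fun x => (hE.false x).elim, hC,
      (ENNReal.lt_ofReal_iff_toReal_lt hct).2 hlt⟩
  have hC0 : 0 ≤ C := (abs_nonneg _).trans (hC x₀)
  -- The losses under `μ` and `ν` are at most `ε` and `exp C * ε`; this choice keeps the total
  -- within half the margin `δ`.
  set ε := δ / (2 * (1 + Real.exp C)) with hε
  have hε0 : 0 < ε := by positivity
  obtain ⟨g, hg, -⟩ :=
    (integrable_of_abs_le (μ := μ + ν) hf hC).exists_boundedContinuous_integral_sub_le hε0
  set h : E → ℝ := fun x => max (-C) (min (g x) C) with hh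
  have hhc : Continuous h := by fun_prop
  have hhC : ∀ x, |h x| ≤ C := fun x =>
    abs_le.2 ⟨le_max_left _ _, max_le (by linarith) (min_le_right _ _)⟩
  have hclip : ∀ x, |f x - h x| ≤ |f x - g x| := by
    intro x
    have := abs_le.1 (hC x)
    simp only [hh]
    rcases le_total (g x) C with h1 | h1 <;> rcases le_total (-C) (g x) with h2 | h2 <;> grind
  have hhm := hhc.measurable
  have hfi : Integrable f (μ + ν) := integrable_of_abs_le hf hC
  have hhi : Integrable h (μ + ν) := integrable_of_abs_le hhm hhC
  have hgi : Integrable (fun x => ‖f x - g x‖) (μ + ν) :=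
    (hfi.sub (BoundedContinuousFunction.integrable _ g)).norm
  have hd : Integrable (fun x => |f x - h x|) (μ + ν) := (hfi.sub hhi).abs
  have hdμ := hd.mono_measure (Measure.le_add_right le_rfl : μ ≤ μ + ν)
  have hdν := hd.mono_measure (Measure.le_add_left le_rfl : ν ≤ μ + ν)
  have hsum : ∫ x, |f x - h x| ∂μ + ∫ x, |f x - h x| ∂ν ≤ ε := by
    rw [← integral_add_measure hdμ hdν]
    exact (integral_mono hd hgi hclip).trans hg
  have h1 : ∫ x, f x ∂μ - ∫ x, h x ∂μ ≤ ∫ x, |f x - h x| ∂μ := by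
    rw [← integral_sub (integrable_of_abs_le hf hC) (integrable_of_abs_le hhm hhC)]
    exact integral_mono ((integrable_of_abs_le hf hC).sub (integrable_of_abs_le hhm hhC)) hdμ
      fun x => le_abs_self _
  have h2 : ∫ x, (Real.exp (h x) - 1) ∂ν - ∫ x, (Real.exp (f x) - 1) ∂ν ≤
      Real.exp C * ∫ x, |f x - h x| ∂ν := by
    rw [← integral_sub (integrable_exp_sub_one hhm hhC) (integrable_exp_sub_one hf hC),
      ← integral_const_mul]
    refine integral_mono ((integrable_exp_sub_one hhm hhC).sub (integrable_exp_sub_one hf hC))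
      (hdν.const_mul _) fun x => ?_
    have := abs_exp_sub_exp_le ((le_abs_self _).trans (hhC x)) ((le_abs_self _).trans (hC x))
    rw [abs_sub_comm (h x)] at this
    have := (le_abs_self _).trans this
    simpa using this
  have h3 : 0 ≤ ∫ x, |f x - h x| ∂μ := integral_nonneg fun x => abs_nonneg _
  have h4 : 0 ≤ ∫ x, |f x - h x| ∂ν := integral_nonneg fun x => abs_nonneg _
  have hε2 : (1 + Real.exp C) * ε = δ / 2 := by
    rw [hε]
    field_simp
  have hexp := Real.exp_pos C
  refine ⟨h, C, hhc, hhC, (ENNReal.lt_ofReal_iff_toReal_lt hct).2 ?_⟩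
  have h5 : klDual μ ν f - klDual μ ν h ≤ δ / 2 := by
    simp only [klDual]
    nlinarith
  linarith

/-- Lower semicontinuity of the relative entropy for the weak convergence of both arguments. -/
theorem klDiv_le_liminf [TopologicalSpace E] [TopologicalSpace.PseudoMetrizableSpace E]
    [BorelSpace E] {μ ν : Measure E} [IsFiniteMeasure μ] [IsFiniteMeasure ν]
    {μs νs : ℕ → Measure E} [∀ n, IsFiniteMeasure (μs n)] [∀ n, IsFiniteMeasure (νs n)]
    (hμ : ∀ (f : E → ℝ) (C : ℝ), Continuous f → (∀ x, |f x| ≤ C) →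
      Tendsto (fun n => ∫ x, f x ∂μs n) atTop (𝓝 (∫ x, f x ∂μ)))
    (hν : ∀ (f : E → ℝ) (C : ℝ), Continuous f → (∀ x, |f x| ≤ C) →
      Tendsto (fun n => ∫ x, f x ∂νs n) atTop (𝓝 (∫ x, f x ∂ν))) :
    klDiv μ ν ≤ liminf (fun n => klDiv (μs n) (νs n)) atTop := by
  refine le_of_forall_lt fun c hc => ?_
  obtain ⟨b, hcb, hb⟩ := exists_between hc
  refine hcb.trans_le ?_
  obtain ⟨f, C, hf, hC, hlt⟩ := exists_continuous_lt_klDual μ ν hb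
  have hlim : Tendsto (fun n => klDual (μs n) (νs n) f) atTop (𝓝 (klDual μ ν f)) := by
    refine (hμ f C hf hC).sub (hν _ (Real.exp C + 1) (by fun_prop) fun x => ?_)
    have h1 := Real.exp_le_exp.2 ((le_abs_self _).trans (hC x))
    have h2 := Real.exp_pos (f x)
    rw [abs_le]
    constructor <;> linarith
  have hev := (ENNReal.continuous_ofReal.tendsto _).comp hlim |>.eventually_const_lt hlt
  refine le_liminf_of_le (by isBoundedDefault) ?_
  filter_upwards [hev] with n hn
  exact hn.le.trans (klDual_le_klDiv _ _ hf.measurable hC)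

/-- Lower semicontinuity of the mutual information under pointwise convergence. -/
theorem mutualInfo_le_liminf {Ω : Type*} [MeasurableSpace Ω] {P : Measure Ω}
    [IsProbabilityMeasure P] {X Y : Ω → ℝ} {Ys : ℕ → Ω → ℝ} (hX : Measurable X) (hY : Measurable Y)
    (hYs : ∀ n, Measurable (Ys n)) (hlim : ∀ ω, Tendsto (fun n => Ys n ω) atTop (𝓝 (Y ω))) :
    mutualInfo P X Y ≤ liminf (fun n => mutualInfo P X (Ys n)) atTop := by
  unfold mutualInfo
  refine klDiv_le_liminf (fun f C hf hC => ?_) (fun f C hf hC => ?_)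
  · have h : ∀ Y' : Ω → ℝ, Measurable Y' →
        ∫ x, f x ∂P.map (fun ω => (X ω, Y' ω)) = ∫ ω, f (X ω, Y' ω) ∂P := fun Y' hY' =>
      integral_map (by fun_prop) hf.measurable.aestronglyMeasurable
    rw [h Y hY]
    simp_rw [h _ (hYs _)]
    refine tendsto_integral_of_dominated_convergence (fun _ => C)
      (fun n => (hf.measurable.comp (hX.prodMk (hYs n))).aestronglyMeasurable)
      (integrable_const _) (fun n => ae_of_all _ fun ω => hC _) (ae_of_all _ fun ω => ?_)
    exact (hf.tendsto _).comp (tendsto_const_nhds.prodMk_nhds (hlim ω))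
  -- The product of the marginals is realized on `Ω × Ω` with independent copies, so that dominated
  -- convergence applies there as well.
  · have h : ∀ Y' : Ω → ℝ, Measurable Y' →
        ∫ x, f x ∂(P.map X).prod (P.map Y') = ∫ q : Ω × Ω, f (X q.1, Y' q.2) ∂P.prod P :=
      fun Y' hY' => by
        rw [Measure.map_prod_map _ _ hX hY',
          integral_map (by fun_prop) hf.measurable.aestronglyMeasurable]
        rfl
    rw [h Y hY]
    simp_rw [h _ (hYs _)]
    refine tendsto_integral_of_dominated_convergence (fun _ => C)
      (fun n => (hf.measurable.comp ((hX.comp measurable_fst).prodMk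
        ((hYs n).comp measurable_snd))).aestronglyMeasurable)
      (integrable_const _) (fun n => ae_of_all _ fun ω => hC _) (ae_of_all _ fun ω => ?_)
    exact (hf.tendsto _).comp (tendsto_const_nhds.prodMk_nhds (hlim _))

end Semicontinuity

/-! ### Subfamilies of independent variables -/

section Mask

variable {ι : Type*}

open scoped Classical in
/-- The family `x` with the entries outside `A` replaced by `0`. -/
noncomputable def mask (A : Set ι) (x : ι → ℝ) (k : ι) : ℝ := if k ∈ A then x k else 0

theorem mask_of_mem {A : Set ι} {k : ι} (h : k ∈ A) (x : ι → ℝ) : mask A x k = x k := if_pos h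

theorem mask_compl_of_notMem {A : Set ι} {k : ι} (h : k ∉ A) (x : ι → ℝ) : mask Aᶜ x k = x k :=
  if_pos h

theorem measurable_mask (A : Set ι) : Measurable (mask A) := by
  refine measurable_pi_lambda _ fun k => ?_
  by_cases h : k ∈ A
  · simpa only [mask, h, if_true] using measurable_pi_apply k
  · simpa only [mask, h, if_false] using measurable_const

variable {Ω : Type*} [MeasurableSpace Ω] {P : Measure Ω} {f : ι → Ω → ℝ}

/-- Disjoint subfamilies of an independent family are independent. -/
theorem indepFun_mask (hf : iIndepFun f P) (hm : ∀ k, Measurable (f k)) {A B : Set ι}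
    (hAB : Disjoint A B) :
    IndepFun (fun ω => mask A (f · ω)) (fun ω => mask B (f · ω)) P := by
  have h := indep_iSup_of_disjoint (fun k => (hm k).comap_le) hf.iIndep hAB
  have key : ∀ C : Set ι, MeasurableSpace.comap (fun ω => mask C (f · ω)) inferInstance ≤
      ⨆ k ∈ C, MeasurableSpace.comap (f k) inferInstance := by
    intro C
    rw [← measurable_iff_comap_le]
    refine @measurable_pi_lambda _ _ _ (_) _ _ fun k => ?_
    by_cases hk : k ∈ C
    · simp only [mask, hk, if_true]
      exact Measurable.of_comap_le (le_iSup₂_of_le k hk le_rfl)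
    · simp only [mask, hk, if_false]
      exact @measurable_const _ _ _ (_) _
  rw [IndepFun_iff_Indep]
  exact indep_of_indep_of_le_left (indep_of_indep_of_le_right h (key B)) (key A)

/-- If the secret and `Y` depend on the variables in `A` only, and the observation `O` is a function
of `Y` and of the remaining variables, then `O` is not more informative than `Y`. -/
theorem mutualInfo_le_of_mask [IsProbabilityMeasure P] (hf : iIndepFun f P)
    (hm : ∀ k, Measurable (f k)) (A : Set ι) {α β γ : Type*} [MeasurableSpace α]
    [MeasurableSpace β] [MeasurableSpace γ] {X : (ι → ℝ) → α} {Y : (ι → ℝ) → β} {O : (ι → ℝ) → γ}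
    {Φ : β × (ι → ℝ) → γ} (hX : Measurable X) (hY : Measurable Y) (hΦ : Measurable Φ)
    (hXA : ∀ x, X (mask A x) = X x) (hYA : ∀ x, Y (mask A x) = Y x)
    (hO : ∀ x, O x = Φ (Y x, mask Aᶜ x)) :
    mutualInfo P (fun ω => X (f · ω)) (fun ω => O (f · ω)) ≤
      mutualInfo P (fun ω => X (f · ω)) (fun ω => Y (f · ω)) := by
  have hfm : Measurable fun ω => (f · ω) := measurable_pi_lambda _ hm
  have hM := (measurable_mask Aᶜ).comp hfm
  simp_rw [hO]
  refine (mutualInfo_comp_le (hX.comp hfm) ((hY.comp hfm).prodMk hM) hΦ).trans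
    (mutualInfo_prodMk_le_of_indepFun (hX.comp hfm) (hY.comp hfm) hM ?_)
  have h := (indepFun_mask hf hm (disjoint_compl_right (a := A))).comp (hX.prodMk hY) measurable_id
  have h1 : (fun ω => ((X ∘ fun ω => (f · ω)) ω, (Y ∘ fun ω => (f · ω)) ω)) =
      (fun x => (X x, Y x)) ∘ fun ω => mask A (f · ω) := by
    funext ω
    simp only [Function.comp_apply, hXA, hYA]
  rw [h1]
  exact h

end Mask

namespace ADQSP

set_option linter.unusedSectionVars false

/-! ### The gauge symmetry of the protocol -/

section Gauge

variable {V : Type*} [Fintype V] [LinearOrder V] (G : SimpleGraph V) [DecidableRel G.Adj]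
  {Ω Ω' : Type*} (H : Set V)

/-- The signed sum of `h` over the darts issuing from `j`. -/
noncomputable def outflow (h : G.Dart → ℝ) (j : V) : ℝ :=
  ∑ e : G.Dart with e.fst = j, weight e * h e

variable {G}

theorem weight_symm (e : G.Dart) : weight e.symm = -weight e := by
  have hne := e.adj.ne
  unfold weight
  simp only [SimpleGraph.Dart.symm_toProd, Prod.fst_swap, Prod.snd_swap]
  rcases lt_or_gt_of_ne hne with h | h
  · simp [h, h.not_gt]
  · simp [h, h.not_gt]

theorem weight_mul_self (e : G.Dart) : weight e * weight e = 1 := by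
  unfold weight
  split_ifs <;> norm_num

theorem xUpdate_gauge (p : Params) (s : V → ℝ) (z h : G.Dart → ℝ) (i : V) :
    xUpdate G p (fun j => s j + outflow G h j) (fun e => z e + h e) i = xUpdate G p s z i := by
  unfold xUpdate outflow
  simp only [mul_add, Finset.sum_add_distrib]
  congr 1
  ring

theorem increment_gauge (p : Params) (s : V → ℝ) (d : ℕ × G.Dart → ℝ) (t : ℕ) (z h : G.Dart → ℝ)
    (hsymm : ∀ e, h e.symm = h e) (e : G.Dart) :
    increment G p (fun j => s j + outflow G h j) d t (fun e => z e + h e) e =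
      increment G p s d t z e := by
  unfold increment
  congr 1
  unfold zUpdate
  rw [xUpdate_gauge]
  simp only [hsymm]
  ring

theorem zHat_gauge (p : Params) (s : V → ℝ) (z h : G.Dart → ℝ) (d : ℕ × G.Dart → ℝ)
    (hsymm : ∀ e, h e.symm = h e) (t : ℕ) :
    zHat G p (fun j => s j + outflow G h j) (fun e => z e + h e) d t =
      fun e => zHat G p s z d t e + h e := by
  induction t with
  | zero => rfl
  | succ t ih =>
    funext e
    simp only [zHat, ih, increment_gauge p s d t _ h hsymm]
    ring

/-- The messages do not change when the same amount is added to the initial values at both ends of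
an edge and the private data are adjusted accordingly. -/
theorem message_gauge (p : Params) (s : V → ℝ) (z h : G.Dart → ℝ) (d : ℕ × G.Dart → ℝ)
    (hsymm : ∀ e, h e.symm = h e) (t : ℕ) (e : G.Dart) :
    message G p (fun j => s j + outflow G h j) (fun e => z e + h e) d t e =
      message G p s z d t e := by
  unfold message
  rw [zHat_gauge p s z h d hsymm, increment_gauge p s d t _ h hsymm]

theorem outflow_eq_zero {H : Set V} {h : G.Dart → ℝ}
    (hsupp : ∀ e : G.Dart, ¬(e.fst ∈ H ∧ e.snd ∈ H) → h e = 0) {j : V} (hj : j ∉ H) :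
    outflow G h j = 0 := by
  refine Finset.sum_eq_zero fun e he => ?_
  rw [Finset.mem_filter] at he
  rw [hsupp e fun hc => hj (he.2 ▸ hc.1), mul_zero]

open scoped Classical in
theorem outflow_eq_sum_honest {H : Set V} {h : G.Dart → ℝ}
    (hsupp : ∀ e : G.Dart, ¬(e.fst ∈ H ∧ e.snd ∈ H) → h e = 0) (j : V) :
    outflow G h j = ∑ e : G.Dart with e.fst = j ∧ e.snd ∈ H, weight e * h e := by
  unfold outflow
  symm
  refine Finset.sum_subset (fun e he => ?_) fun e he hne => ?_
  · simp only [Finset.mem_filter] at he ⊢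
    exact ⟨he.1, he.2.1⟩
  · simp only [Finset.mem_filter, Finset.mem_univ, true_and] at he hne
    rw [hsupp e fun hc => hne ⟨he, hc.2⟩, mul_zero]

/-- A gauge supported on honest edges touches neither the initial values on corrupt edges nor the
data of corrupt nodes. The two families may live on different sample spaces, since the gauged one
will be a function of the reduced data. -/
theorem view_gauge (p : Params) {S : V → Ω → ℝ} {Z : G.Dart → Ω → ℝ} {D : ℕ × G.Dart → Ω → ℝ}
    {S' : V → Ω' → ℝ} {Z' : G.Dart → Ω' → ℝ} {D' : ℕ × G.Dart → Ω' → ℝ} (T : ℕ∞) {ω : Ω} {ω' : Ω'}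
    (h : G.Dart → ℝ) (hsymm : ∀ e, h e.symm = h e)
    (hsupp : ∀ e : G.Dart, ¬(e.fst ∈ H ∧ e.snd ∈ H) → h e = 0)
    (hS : ∀ j, S' j ω' = S j ω + outflow G h j) (hZ : ∀ e, Z' e ω' = Z e ω + h e)
    (hD : ∀ te, D' te ω' = D te ω) :
    view G H p S' Z' D' T ω' = view G H p S Z D T ω := by
  unfold view
  simp only [hS, hZ, hD]
  refine Prod.ext ?_ (Prod.ext ?_ ?_)
  · funext j
    simp only [outflow_eq_zero hsupp j.2, add_zero]
  · funext e
    simp only [hsupp e e.2, add_zero]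
  · funext te
    exact message_gauge p _ _ h _ hsymm _ _

/-- The compensation of the private value cancels the change of the signed sum, and a symmetric `h`
cancels in the differences. Only the private data of the component matter here. -/
theorem perturbed_gauge (i : V) {S : V → Ω → ℝ} {Z : G.Dart → Ω → ℝ}
    {S' : V → Ω' → ℝ} {Z' : G.Dart → Ω' → ℝ} {ω : Ω} {ω' : Ω'}
    (h : G.Dart → ℝ) (hsymm : ∀ e, h e.symm = h e)
    (hsupp : ∀ e : G.Dart, ¬(e.fst ∈ H ∧ e.snd ∈ H) → h e = 0)
    (hS : ∀ j ∈ honestComponent G H i, S' j ω' = S j ω + outflow G h j)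
    (hZ : ∀ e, Z' e ω' = Z e ω + h e) :
    perturbed G H i S' Z' ω' = perturbed G H i S Z ω := by
  unfold perturbed
  refine Prod.ext ?_ ?_
  · funext j
    simp only [hS j j.2, hZ, mul_add, Finset.sum_add_distrib, outflow_eq_sum_honest hsupp]
    ring
  · funext e
    simp only [hZ, hsymm]
    ring

end Gauge

/-! ### Connected components of the honest subgraph -/

section Component

variable {V : Type*} [Fintype V] [LinearOrder V] {G : SimpleGraph V} {H : Set V} {i j k : V}

theorem honestComponent_subset : honestComponent G H i ⊆ H := fun _ ⟨_, hj, _⟩ => hj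

theorem self_mem_honestComponent (hi : i ∈ H) : i ∈ honestComponent G H i :=
  ⟨hi, hi, SimpleGraph.Reachable.refl _⟩

theorem mem_honestComponent_of_adj (hj : j ∈ honestComponent G H i) (hk : k ∈ H)
    (h : G.Adj j k) : k ∈ honestComponent G H i := by
  obtain ⟨hi, hj', hr⟩ := hj
  exact ⟨hi, hk, hr.trans (SimpleGraph.Adj.reachable (by simpa using h))⟩

theorem mem_honestComponent_iff (hi : i ∈ H) (hj : j ∈ H) :
    j ∈ honestComponent G H i ↔
      (G.induce H).connectedComponentMk ⟨j, hj⟩ = (G.induce H).connectedComponentMk ⟨i, hi⟩ := by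
  rw [SimpleGraph.ConnectedComponent.eq]
  exact ⟨fun ⟨_, _, hr⟩ => hr.symm, fun hr => ⟨hi, hj, hr.symm⟩⟩

end Component

/-! ### Measurability of the protocol and of the views -/

section Measurability

variable {V : Type*} [Fintype V] [LinearOrder V] {G : SimpleGraph V} [DecidableRel G.Adj]
  {Ω : Type*} [MeasurableSpace Ω] (H : Set V) (p : Params) {S : V → Ω → ℝ} {Z : G.Dart → Ω → ℝ}
  {D : ℕ × G.Dart → Ω → ℝ}

theorem measurable_quantize (t : ℕ) : Measurable (p.quantize t) := by
  have h : Measurable fun a : ℤ => ((clampIndex p.bits a : ℤ) : ℝ) := Measurable.of_discrete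
  have h2 : Measurable fun x : ℝ => ((clampIndex p.bits ⌊x / p.cellWidth t⌋ : ℤ) : ℝ) :=
    h.comp (Int.measurable_floor.comp (measurable_id.div_const _))
  exact (h2.add_const _).const_mul _

theorem measurable_increment (hS : ∀ j, Measurable (S j)) (hD : ∀ te, Measurable (D te))
    (t : ℕ) {z : G.Dart → Ω → ℝ} (hz : ∀ e, Measurable (z e)) (e : G.Dart) :
    Measurable fun ω => increment G p (S · ω) (D · ω) t (z · ω) e := by
  have hx : ∀ i, Measurable fun ω => xUpdate G p (S · ω) (z · ω) i := fun i =>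
    ((hS i).sub (Finset.measurable_sum _ fun e _ => (hz e).const_mul _)).div_const _
  have hu : Measurable fun ω => zUpdate G p (S · ω) (z · ω) e :=
    ((hz e).const_mul _).add (((hz e.symm).add ((hx _).const_mul _)).const_mul _)
  exact ((measurable_quantize p _).comp ((hu.sub (hz e)).add (hD _))).sub (hD _)

theorem measurable_zHat (hS : ∀ j, Measurable (S j)) (hZ : ∀ e, Measurable (Z e))
    (hD : ∀ te, Measurable (D te)) (t : ℕ) (e : G.Dart) :
    Measurable fun ω => zHat G p (S · ω) (Z · ω) (D · ω) t e := by
  induction t generalizing e with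
  | zero => exact hZ e
  | succ t ih => exact (ih e).add (measurable_increment p hS hD t ih e)

theorem measurable_view (hS : ∀ j, Measurable (S j)) (hZ : ∀ e, Measurable (Z e))
    (hD : ∀ te, Measurable (D te)) (T : ℕ∞) : Measurable (view G H p S Z D T) :=
  (measurable_pi_lambda _ fun _ => hS _).prodMk <| (measurable_pi_lambda _ fun _ => hZ _).prodMk <|
    measurable_pi_lambda _ fun _ =>
      measurable_increment p hS hD _ (measurable_zHat p hS hZ hD _) _

theorem measurable_perturbed (i : V) (hS : ∀ j, Measurable (S j)) (hZ : ∀ e, Measurable (Z e)) :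
    Measurable (perturbed G H i S Z) :=
  (measurable_pi_lambda _ fun _ =>
    (hS _).sub (Finset.measurable_sum _ fun e _ => (hZ e).const_mul _)).prodMk <|
    measurable_pi_lambda _ fun _ => (hZ _).sub (hZ _)

theorem measurable_componentSum (i : V) (hS : ∀ j, Measurable (S j)) :
    Measurable (componentSum G H i S) :=
  Finset.measurable_sum _ fun j _ => hS j

theorem measurable_idealView (hS : ∀ j, Measurable (S j)) :
    Measurable (idealView G H S) :=
  (measurable_pi_lambda _ fun _ => hS _).prodMk <| measurable_pi_lambda _ fun _ =>
    Finset.measurable_sum _ fun j _ => hS j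

end Measurability

/-! ### The view is no more informative than the perturbed quantities -/

section UpperBound

variable {V : Type*} [Fintype V] [LinearOrder V] {G : SimpleGraph V} [DecidableRel G.Adj]
  {H : Set V} {i : V} {Ω : Type*} [MeasurableSpace Ω] {P : Measure Ω} [IsProbabilityMeasure P]
  {p : Params} {v : ℝ≥0} {S : V → Ω → ℝ} {Z : G.Dart → Ω → ℝ} {D : ℕ × G.Dart → Ω → ℝ}

variable (G) in
/-- The labels of the private data, the initial values and the dithers. -/
abbrev Label : Type _ := V ⊕ (G.Dart ⊕ (ℕ × G.Dart))

variable (G H i) in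
/-- The labels of the private data and of the initial values in the honest component of `i`. -/
def componentLabels : Set (Label G) :=
  {k | Sum.elim (· ∈ honestComponent G H i) (Sum.elim (fun e : G.Dart =>
    e.fst ∈ honestComponent G H i ∧ e.snd ∈ honestComponent G H i) fun _ => False) k}

theorem IsRandomness.measurable (h : IsRandomness G P p v S Z D) (k : Label G) :
    Measurable (Sum.elim S (Sum.elim Z D) k) := by
  rcases k with j | e | te
  exacts [h.measurable_S j, h.measurable_Z e, h.measurable_D te]

variable (G H i) in
open scoped Classical in
/-- Initial values which vanish at the larger end of each edge of the component, recovered from the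
perturbed quantities. -/
noncomputable def gaugedZ (e : G.Dart)
    (x : (({j : V // j ∈ honestComponent G H i} → ℝ) ×
      ({e : G.Dart // e.fst ∈ honestComponent G H i ∧ e.snd ∈ honestComponent G H i} → ℝ)) ×
      (Label G → ℝ)) : ℝ :=
  if hc : e.fst ∈ honestComponent G H i ∧ e.snd ∈ honestComponent G H i then
    if e.fst < e.snd then x.1.2 ⟨e, hc⟩ else 0
  else x.2 (.inr (.inl e))

variable (G H i) in
open scoped Classical in
/-- The private data which go with the initial values `gaugedZ`. -/
noncomputable def gaugedS (j : V)
    (x : (({j : V // j ∈ honestComponent G H i} → ℝ) ×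
      ({e : G.Dart // e.fst ∈ honestComponent G H i ∧ e.snd ∈ honestComponent G H i} → ℝ)) ×
      (Label G → ℝ)) : ℝ :=
  if hj : j ∈ honestComponent G H i then
    x.1.1 ⟨j, hj⟩ + ∑ e : G.Dart with e.fst = j ∧ e.snd ∈ H, weight e * gaugedZ G H i e x
  else x.2 (.inl j)

theorem measurable_gaugedZ (e : G.Dart) : Measurable (gaugedZ G H i e) := by
  unfold gaugedZ
  split_ifs <;> fun_prop

theorem measurable_gaugedS (j : V) : Measurable (gaugedS G H i j) := by
  have := measurable_gaugedZ (G := G) (H := H) (i := i)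
  unfold gaugedS
  split_ifs <;> fun_prop

/-- An honest neighbour of a node of the component is again in the component, so only labels of the
component occur. -/
theorem perturbed_mask (x : Label G → ℝ) :
    perturbed G H i (fun j x => x (.inl j)) (fun e (x : Label G → ℝ) => x (.inr (.inl e)))
      (mask (componentLabels G H i) x) =
    perturbed G H i (fun j x => x (.inl j)) (fun e (x : Label G → ℝ) => x (.inr (.inl e))) x := by
  unfold perturbed
  refine Prod.ext ?_ ?_
  · funext j
    have hj : (.inl (j : V) : Label G) ∈ componentLabels G H i := j.2
    simp only [mask_of_mem hj]
    congr 1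
    refine Finset.sum_congr rfl fun e he => ?_
    simp only [Finset.mem_filter] at he
    have hf : e.fst ∈ honestComponent G H i := he.2.1 ▸ j.2
    have hem : (.inr (.inl e) : Label G) ∈ componentLabels G H i :=
      ⟨hf, mem_honestComponent_of_adj hf he.2.2 e.adj⟩
    rw [mask_of_mem hem]
  · funext e
    have h1 : (.inr (.inl (e : G.Dart)) : Label G) ∈ componentLabels G H i := e.2
    have h2 : (.inr (.inl (e : G.Dart).symm) : Label G) ∈ componentLabels G H i := e.2.symm
    simp only [mask_of_mem h1, mask_of_mem h2]

/-- The messages are a function of the perturbed quantities of a component and of the variables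
outside of it. -/
theorem view_eq_view_gauged (T : ℕ∞) (x : Label G → ℝ) :
    view G H p (fun j x => x (.inl j)) (fun e (x : Label G → ℝ) => x (.inr (.inl e)))
        (fun te x => x (.inr (.inr te))) T x =
      view G H p (gaugedS G H i) (gaugedZ G H i) (fun te x => x.2 (.inr (.inr te))) T
        (perturbed G H i (fun j x => x (.inl j)) (fun e (x : Label G → ℝ) => x (.inr (.inl e))) x,
          mask (componentLabels G H i)ᶜ x) := by
  classical
  -- On both darts of a component edge, subtract the initial value held at the larger end: the
  -- smaller end is left with the difference, the larger end with `0`.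
  set h : G.Dart → ℝ := fun e =>
    if e.fst ∈ honestComponent G H i ∧ e.snd ∈ honestComponent G H i then
      if e.fst < e.snd then -x (.inr (.inl e.symm)) else -x (.inr (.inl e)) else 0 with hh
  have hsupp : ∀ e : G.Dart, ¬(e.fst ∈ H ∧ e.snd ∈ H) → h e = 0 := fun e he =>
    if_neg fun hc => he ⟨honestComponent_subset hc.1, honestComponent_subset hc.2⟩
  have hZ : ∀ e, gaugedZ G H i e
      (perturbed G H i (fun j x => x (.inl j)) (fun e (x : Label G → ℝ) => x (.inr (.inl e))) x,
          mask (componentLabels G H i)ᶜ x) = x (.inr (.inl e)) + h e := by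
    intro e
    by_cases hc : e.fst ∈ honestComponent G H i ∧ e.snd ∈ honestComponent G H i
    · by_cases hlt : e.fst < e.snd
      · simp only [gaugedZ, hh, dif_pos hc, if_pos hc, if_pos hlt, perturbed]
        ring
      · simp only [gaugedZ, hh, dif_pos hc, if_pos hc, if_neg hlt, add_neg_cancel]
    · have hm : (.inr (.inl e) : Label G) ∉ componentLabels G H i := hc
      simp only [gaugedZ, hh, dif_neg hc, if_neg hc, mask_compl_of_notMem hm, add_zero]
  refine (view_gauge H p T h (fun e => ?_) hsupp (fun j => ?_) hZ fun te => ?_).symm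
  · simp only [hh, SimpleGraph.Dart.symm_toProd, Prod.fst_swap, Prod.snd_swap,
      SimpleGraph.Dart.symm_symm, and_comm]
    rcases lt_or_gt_of_ne e.adj.ne with hlt | hlt <;> simp [hlt, hlt.not_gt]
  · by_cases hj : j ∈ honestComponent G H i
    · rw [gaugedS, dif_pos hj, outflow_eq_sum_honest hsupp]
      simp_rw [hZ, mul_add, Finset.sum_add_distrib]
      simp only [perturbed]
      ring
    · have hm : (.inl j : Label G) ∉ componentLabels G H i := hj
      have h0 : outflow G h j = 0 := outflow_eq_zero (H := honestComponent G H i)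
        (fun e he => if_neg he) hj
      rw [gaugedS, dif_neg hj, h0, add_zero]
      exact mask_compl_of_notMem hm x
  · have hm : (.inr (.inr te) : Label G) ∉ componentLabels G H i := id
    exact mask_compl_of_notMem hm x

theorem mutualInfo_view_le (h : IsRandomness G P p v S Z D) (hi : i ∈ H) (T : ℕ∞) :
    mutualInfo P (S i) (view G H p S Z D T) ≤ mutualInfo P (S i) (perturbed G H i S Z) :=
  mutualInfo_le_of_mask h.indep h.measurable (componentLabels G H i) (X := fun x => x (.inl i))
    (Y := perturbed G H i (fun j (x : Label G → ℝ) => x (.inl j))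
      fun e (x : Label G → ℝ) => x (.inr (.inl e)))
    (O := view G H p (fun j (x : Label G → ℝ) => x (.inl j))
      (fun e (x : Label G → ℝ) => x (.inr (.inl e)))
      (fun te (x : Label G → ℝ) => x (.inr (.inr te))) T)
    (measurable_pi_apply _)
    (measurable_perturbed H i (fun _ => measurable_pi_apply _) fun _ => measurable_pi_apply _)
    (measurable_view H p measurable_gaugedS measurable_gaugedZ
      (fun _ => (measurable_pi_apply _).comp measurable_snd) T)
    (fun x => mask_of_mem (show .inl i ∈ componentLabels G H i from self_mem_honestComponent hi) x)
    perturbed_mask (view_eq_view_gauged T)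

end UpperBound

/-! ### The component sum and the ideal world -/

section ComponentSum

variable {V : Type*} [Fintype V] [LinearOrder V] {G : SimpleGraph V} [DecidableRel G.Adj]
  {H : Set V} {i : V} {Ω : Type*}

theorem sum_weight_symm {c : G.Dart → Prop} [DecidablePred c] (hc : ∀ e, c e.symm ↔ c e)
    (z : G.Dart → ℝ) :
    ∑ e : G.Dart with c e, weight e * z e.symm = -∑ e : G.Dart with c e, weight e * z e := by
  rw [← Finset.sum_neg_distrib]
  refine Finset.sum_nbij' (fun e => e.symm) (fun e => e.symm) ?_ ?_ ?_ ?_ ?_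
  · simp [hc]
  · simp [hc]
  · simp
  · simp
  · intro e _
    rw [weight_symm]
    ring

open scoped Classical in
theorem sum_component_fst {q : G.Dart → Prop} [DecidablePred q] (g : G.Dart → ℝ) :
    ∑ j : V with j ∈ honestComponent G H i, ∑ e : G.Dart with e.fst = j ∧ q e, g e =
      ∑ e : G.Dart with e.fst ∈ honestComponent G H i ∧ q e, g e := by
  rw [Finset.sum_comm' (s' := fun e : G.Dart => {e.fst})
    (t' := Finset.univ.filter fun e : G.Dart => e.fst ∈ honestComponent G H i ∧ q e)]
  · simp
  · intro j e
    simp only [Finset.mem_filter, Finset.mem_univ, true_and, Finset.mem_singleton]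
    constructor
    · rintro ⟨hj, rfl, hq⟩
      exact ⟨rfl, hj, hq⟩
    · rintro ⟨rfl, hj, hq⟩
      exact ⟨hj, rfl, hq⟩

theorem fst_mem_and_snd_honest_iff (e : G.Dart) :
    (e.fst ∈ honestComponent G H i ∧ e.snd ∈ H) ↔
      (e.fst ∈ honestComponent G H i ∧ e.snd ∈ honestComponent G H i) :=
  ⟨fun h => ⟨h.1, mem_honestComponent_of_adj h.1 h.2 e.adj⟩,
    fun h => ⟨h.1, honestComponent_subset h.2⟩⟩

-- Symmetrization: reversing a dart changes the sign of its weight, so the sum sees only the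
-- antisymmetric part of `z`.
open scoped Classical in
theorem sum_weight_component (z : G.Dart → ℝ) :
    ∑ e : G.Dart with e.fst ∈ honestComponent G H i ∧ e.snd ∈ H, weight e * z e =
      2⁻¹ * ∑ e : G.Dart with e.fst ∈ honestComponent G H i ∧ e.snd ∈ honestComponent G H i,
        weight e * (z e - z e.symm) := by
  simp only [fst_mem_and_snd_honest_iff, mul_sub, Finset.sum_sub_distrib]
  rw [sum_weight_symm fun e => by
    simp only [SimpleGraph.Dart.symm_toProd, Prod.fst_swap, Prod.snd_swap, and_comm]]
  ring

-- Summing the masked private data over the component leaves only differences of `Z` across its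
-- edges, which are observed too. Each edge is counted by two darts, hence the factor `2⁻¹`.
open scoped Classical in
theorem componentSum_eq_perturbed (S : V → Ω → ℝ) (Z : G.Dart → Ω → ℝ) (ω : Ω) :
    componentSum G H i S ω = ∑ j, (perturbed G H i S Z ω).1 j +
      2⁻¹ * ∑ e : {e : G.Dart // e.fst ∈ honestComponent G H i ∧ e.snd ∈ honestComponent G H i},
        weight (e : G.Dart) * (perturbed G H i S Z ω).2 e := by
  have h1 : ∑ j, (perturbed G H i S Z ω).1 j = ∑ j : V with j ∈ honestComponent G H i,
      (S j ω - ∑ e : G.Dart with e.fst = j ∧ e.snd ∈ H, weight e * Z e ω) :=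
    (Finset.sum_subtype (Finset.univ.filter (· ∈ honestComponent G H i)) (by simp)
      fun j => S j ω - ∑ e : G.Dart with e.fst = j ∧ e.snd ∈ H, weight e * Z e ω).symm
  have h2 : ∑ e : {e : G.Dart // e.fst ∈ honestComponent G H i ∧ e.snd ∈ honestComponent G H i},
      weight (e : G.Dart) * (perturbed G H i S Z ω).2 e =
      ∑ e : G.Dart with e.fst ∈ honestComponent G H i ∧ e.snd ∈ honestComponent G H i,
        weight e * (Z e ω - Z e.symm ω) :=
    (Finset.sum_subtype (Finset.univ.filter fun e : G.Dart =>
      e.fst ∈ honestComponent G H i ∧ e.snd ∈ honestComponent G H i) (by simp)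
      fun e : G.Dart => weight e * (Z e ω - Z e.symm ω)).symm
  rw [h1, h2, Finset.sum_sub_distrib, sum_component_fst, sum_weight_component fun e => Z e ω,
    componentSum]
  ring

variable [MeasurableSpace Ω] {P : Measure Ω} [IsProbabilityMeasure P] {p : Params} {v : ℝ≥0}
  {S : V → Ω → ℝ} {Z : G.Dart → Ω → ℝ} {D : ℕ × G.Dart → Ω → ℝ}

theorem mutualInfo_componentSum_le_perturbed (hS : ∀ j, Measurable (S j))
    (hZ : ∀ e, Measurable (Z e)) :
    mutualInfo P (S i) (componentSum G H i S) ≤ mutualInfo P (S i) (perturbed G H i S Z) := by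
  classical
  have h := mutualInfo_comp_le (P := P) (hS i) (measurable_perturbed H i hS hZ)
    (g := fun y => ∑ j, y.1 j + 2⁻¹ *
      ∑ e : {e : G.Dart // e.fst ∈ honestComponent G H i ∧ e.snd ∈ honestComponent G H i},
        weight (e : G.Dart) * y.2 e) (by fun_prop)
  simpa only [← componentSum_eq_perturbed] using h

open scoped Classical in
theorem sum_connectedComponentMk (hi : i ∈ H) (g : V → ℝ) :
    ∑ j : H with (G.induce H).connectedComponentMk j = (G.induce H).connectedComponentMk ⟨i, hi⟩,
      g j = ∑ j : V with j ∈ honestComponent G H i, g j := by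
  refine Finset.sum_nbij (fun j => (j : V)) ?_ (Subtype.val_injective.injOn) ?_ fun _ _ => rfl
  · intro j hj
    simpa [mem_honestComponent_iff hi j.2] using hj
  · intro j hj
    have hj' : j ∈ honestComponent G H i := by simpa using hj
    exact ⟨⟨j, honestComponent_subset hj'⟩,
      by simpa using (mem_honestComponent_iff hi (honestComponent_subset hj')).1 hj', rfl⟩

/-- In the ideal world, the adversary learns no more than the sum over the honest component. -/
theorem mutualInfo_idealView (h : IsRandomness G P p v S Z D) (hi : i ∈ H) :
    mutualInfo P (S i) (idealView G H S) = mutualInfo P (S i) (componentSum G H i S) := by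
  classical
  have hmk : ∀ ω, (idealView G H S ω).2 ((G.induce H).connectedComponentMk ⟨i, hi⟩) =
      componentSum G H i S ω := fun ω => sum_connectedComponentMk hi fun j => S j ω
  refine le_antisymm ?_ ?_
  · refine mutualInfo_le_of_mask h.indep h.measurable (componentLabels G H i)
      (X := fun x => x (.inl i)) (Y := componentSum G H i fun j (x : Label G → ℝ) => x (.inl j))
      (O := idealView G H fun j (x : Label G → ℝ) => x (.inl j))
      -- The other components and the corrupt nodes carry only labels outside the component of `i`,
      -- so they are read from the masked family.
      (Φ := fun y => (fun j => y.2 (.inl j), fun C =>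
        if C = (G.induce H).connectedComponentMk ⟨i, hi⟩ then y.1 else
          ∑ j : H with (G.induce H).connectedComponentMk j = C, y.2 (.inl j)))
      (measurable_pi_apply _) (measurable_componentSum H i fun _ => measurable_pi_apply _)
      ?_ ?_ ?_ ?_
    · refine (measurable_pi_lambda _ fun j => (measurable_pi_apply _).comp measurable_snd).prodMk
        (measurable_pi_lambda _ fun C => ?_)
      split_ifs
      · exact measurable_fst
      · exact Finset.measurable_sum _ fun j _ => (measurable_pi_apply _).comp measurable_snd
    · exact mask_of_mem (show .inl i ∈ componentLabels G H i from self_mem_honestComponent hi)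
    · intro x
      refine Finset.sum_congr rfl fun j hj => ?_
      rw [Finset.mem_filter] at hj
      exact mask_of_mem (show .inl j ∈ componentLabels G H i from hj.2) x
    · intro x
      refine Prod.ext (funext fun j => ?_) (funext fun C => ?_)
      · refine (mask_compl_of_notMem (k := .inl (j : V)) (fun hj => j.2 ?_) x).symm
        exact honestComponent_subset hj
      · by_cases hC : C = (G.induce H).connectedComponentMk ⟨i, hi⟩
        · subst hC
          simp only [if_true]
          exact sum_connectedComponentMk hi fun j => x (.inl j)
        · simp only [if_neg hC]
          refine Finset.sum_congr rfl fun j hj => ?_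
          rw [Finset.mem_filter] at hj
          refine (mask_compl_of_notMem (k := .inl (j : V)) (fun hj' => hC ?_) x).symm
          rw [← hj.2]
          exact (mem_honestComponent_iff hi j.2).1 hj'
  · have h' := mutualInfo_comp_le (P := P) (h.measurable_S i)
      (measurable_idealView (G := G) H h.measurable_S)
      (g := fun y => y.2 ((G.induce H).connectedComponentMk ⟨i, hi⟩)) (by fun_prop)
    simpa only [hmk] using h'

end ComponentSum

/-! ### Flows along honest walks -/

section Flow

variable {V : Type*} [Fintype V] [LinearOrder V] {G : SimpleGraph V} [DecidableRel G.Adj]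
  {H : Set V}

theorem outflow_add (h h' : G.Dart → ℝ) (k : V) :
    outflow G (fun e => h e + h' e) k = outflow G h k + outflow G h' k := by
  simp only [outflow, mul_add, Finset.sum_add_distrib]

theorem outflow_sum {ι : Type*} (s : Finset ι) (a : ι → ℝ) (φ : ι → G.Dart → ℝ) (k : V) :
    outflow G (fun e => ∑ j ∈ s, a j * φ j e) k = ∑ j ∈ s, a j * outflow G (φ j) k := by
  simp only [outflow, Finset.mul_sum]
  rw [Finset.sum_comm]
  exact Finset.sum_congr rfl fun j _ => Finset.sum_congr rfl fun e _ => by ring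

theorem outflow_single (d : G.Dart) (a : ℝ) (k : V) :
    outflow G (fun e => if e = d then a else 0) k = if d.fst = k then weight d * a else 0 := by
  simp only [outflow, mul_ite, mul_zero, Finset.sum_ite_eq', Finset.mem_filter, Finset.mem_univ,
    true_and]

/-- A unit flow along a walk of honest nodes. -/
theorem exists_flow {u w : H} (q : (G.induce H).Walk u w) :
    ∃ φ : G.Dart → ℝ, (∀ e, φ e.symm = φ e) ∧
      (∀ e : G.Dart, ¬(e.fst ∈ H ∧ e.snd ∈ H) → φ e = 0) ∧
      ∀ k, outflow G φ k = (if (w : V) = k then 1 else 0) - if (u : V) = k then 1 else 0 := by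
  induction q with
  | nil => exact ⟨fun _ => 0, fun _ => rfl, fun _ _ => rfl, fun k => by simp [outflow]⟩
  | @cons u x w hadj q ih =>
    obtain ⟨φ, hs, hz, ho⟩ := ih
    have hadj' : G.Adj u x := by simpa using hadj
    set d : G.Dart := ⟨((u : V), (x : V)), hadj'⟩ with hd
    -- The value `-weight d` on both orientations of the new edge has outflow `-1` at `u` and `1` at
    -- `x`, since weights are signs and change under reversal.
    refine ⟨fun e => φ e + ((if e = d then -weight d else 0) +
      if e = d.symm then -weight d else 0), fun e => ?_, fun e he => ?_, fun k => ?_⟩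
    · have h1 : e.symm = d ↔ e = d.symm := by
        rw [← SimpleGraph.Dart.symm_involutive.injective.eq_iff, SimpleGraph.Dart.symm_symm]
      have h2 : e.symm = d.symm ↔ e = d := SimpleGraph.Dart.symm_involutive.injective.eq_iff
      simp only [hs, h1, h2]
      ring
    · have h1 : e ≠ d := by
        rintro rfl
        exact he ⟨u.2, x.2⟩
      have h2 : e ≠ d.symm := by
        rintro rfl
        exact he ⟨x.2, u.2⟩
      simp [hz e he, h1, h2]
    · rw [outflow_add, outflow_add, outflow_single, outflow_single, ho, weight_symm]
      have h1 : d.fst = (u : V) := rfl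
      have h2 : d.symm.fst = (x : V) := rfl
      rw [h1, h2, mul_neg, neg_mul_neg, weight_mul_self]
      split_ifs <;> ring

end Flow

/-! ### Leakage through Gaussian masks -/

section Noise

variable {V : Type*} [Fintype V] [LinearOrder V] {G : SimpleGraph V} [DecidableRel G.Adj]
  {H : Set V} {i : V} {Ω : Type*} [MeasurableSpace Ω] {P : Measure Ω} [IsProbabilityMeasure P]
  {p : Params} {S : V → Ω → ℝ}

/-- Linear statistics of the private data, observed together with `A`, leak little when they are
masked by the initial values. -/
theorem mutualInfo_prodMk_masked_le {v : ℝ≥0} (hv : v ≠ 0) {Z : G.Dart → Ω → ℝ}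
    {D : ℕ × G.Dart → Ω → ℝ} (h : IsRandomness G P p v S Z D) {A : (V → ℝ) → ℝ} (hA : Measurable A)
    {F : G.Dart → (V → ℝ) → ℝ} (hF : ∀ e, Measurable (F e))
    (hL : ∀ e, MemLp (fun ω => F e (S · ω)) 2 P) (s : Finset G.Dart) :
    mutualInfo P (S i) (fun ω => (A (S · ω),
        fun e : G.Dart => if e ∈ s then F e (S · ω) + Z e ω else 0)) ≤
      mutualInfo P (S i) (fun ω => A (S · ω)) +
        ENNReal.ofReal ((∑ e ∈ s, ∫ ω, F e (S · ω) ^ 2 ∂P) / (2 * v)) := by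
  have hSm : Measurable fun ω => (S · ω) := measurable_pi_lambda _ h.measurable_S
  have hZm := h.measurable_Z
  have hAm : Measurable fun ω => A (S · ω) := hA.comp hSm
  have hFm : ∀ e, Measurable fun ω => F e (S · ω) := fun e => (hF e).comp hSm
  induction s using Finset.induction_on with
  | empty =>
    refine le_trans ?_ le_self_add
    have h1 := mutualInfo_comp_le (P := P) (h.measurable_S i) hAm
      (g := fun a => (a, fun _ : G.Dart => (0 : ℝ))) (by fun_prop)
    simpa using h1
  | insert a s ha ih =>
    set B : Ω → ℝ × (G.Dart → ℝ) := fun ω => (A (S · ω),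
        fun e : G.Dart => if e ∈ s then F e (S · ω) + Z e ω else 0) with hB
    have hBm : Measurable B := by
      refine hAm.prodMk (measurable_pi_lambda _ fun e => ?_)
      split_ifs
      · exact (hFm e).add (hZm e)
      · exact measurable_const
    have hind : IndepFun (fun ω => (S i ω, B ω, F a (S · ω))) (Z a) P := by
      -- All private data and the initial values on `s`: what has been observed so far, together
      -- with the next signal `F a`, depends on these labels only, and `Z a` is not among them.
      set C : Set (Label G) := {k | Sum.elim (fun _ => True) (Sum.elim (· ∈ s) fun _ => False) k}
      have hdis : Disjoint C {.inr (.inl a)} := Set.disjoint_singleton_right.2 ha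
      have hm := indepFun_mask h.indep h.measurable hdis
      have h1 : Measurable fun x : Label G → ℝ => fun j => x (.inl j) := by fun_prop
      have hφ : Measurable fun x : Label G → ℝ => (x (.inl i), (A fun j => x (.inl j),
          fun e : G.Dart => if e ∈ s then F e (fun j => x (.inl j)) + x (.inr (.inl e)) else 0),
          F a fun j => x (.inl j)) := by
        refine (measurable_pi_apply _).prodMk (((hA.comp h1).prodMk ?_).prodMk ((hF a).comp h1))
        refine measurable_pi_lambda _ fun e => ?_
        split_ifs
        · exact ((hF e).comp h1).add (measurable_pi_apply _)
        · exact measurable_const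
      have hψ : Measurable fun x : Label G → ℝ => x (.inr (.inl a)) := measurable_pi_apply _
      have hcomp := hm.comp hφ hψ
      convert hcomp using 1
      · funext ω
        have h1 : ∀ j, (.inl j : Label G) ∈ C := fun j => trivial
        simp only [Function.comp_apply, mask_of_mem (h1 _), Sum.elim_inl, hB]
        congr 3
        funext e
        by_cases he : e ∈ s
        · have h2 : (.inr (.inl e) : Label G) ∈ C := he
          simp [he, mask_of_mem h2]
        · simp [he]
      · funext ω
        simp [mask]
    have h1 := mutualInfo_prodMk_add_gaussian_le hv (h.measurable_S i) hBm (hFm a) (hZm a)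
      (h.law_Z a) hind (hL a)
    have h2 := mutualInfo_comp_le (P := P) (h.measurable_S i) (hBm.prodMk ((hFm a).add (hZm a)))
      (g := fun y => (y.1.1, fun e : G.Dart => if e = a then y.2 else y.1.2 e)) (by
        refine (by fun_prop : Measurable fun y : (ℝ × (G.Dart → ℝ)) × ℝ => y.1.1).prodMk
          (measurable_pi_lambda _ fun e => ?_)
        split_ifs <;> fun_prop)
    have h3 : (fun ω => (A (S · ω),
        fun e : G.Dart => if e ∈ insert a s then F e (S · ω) + Z e ω else 0)) =
        fun ω => ((B ω).1, fun e : G.Dart => if e = a then F a (S · ω) + Z a ω else (B ω).2 e) := by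
      funext ω
      refine Prod.ext rfl (funext fun e => ?_)
      by_cases he : e = a
      · subst he; simp
      · simp [he, hB]
    rw [h3, Finset.sum_insert ha, add_comm (∫ ω, _ ∂P), add_div, ENNReal.ofReal_add
      (div_nonneg (Finset.sum_nonneg fun e _ => integral_nonneg fun ω => sq_nonneg _)
        (by positivity)) (div_nonneg (integral_nonneg fun ω => sq_nonneg _) (by positivity)),
      ← add_assoc]
    exact h2.trans (h1.trans (by gcongr))

/-- The gauge `F e = ∑ S_j φ_j e`, with `φ_j` a unit flow of outflow `1` at `i` and `-1` at `j`,
moves every private value of the component to `i`. The constant is the total second moment of the `F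
e`; it depends on the private data only, not on the noise. -/
theorem exists_mutualInfo_perturbed_le
    (hL : ∀ j ∈ honestComponent G H i, MemLp (S j) 2 P) :
    ∃ C : ℝ, ∀ (v : ℝ≥0) (Z : G.Dart → Ω → ℝ) (D : ℕ × G.Dart → Ω → ℝ), v ≠ 0 →
      IsRandomness G P p v S Z D → mutualInfo P (S i) (perturbed G H i S Z) ≤
        mutualInfo P (S i) (componentSum G H i S) + ENNReal.ofReal (C / (2 * v)) := by
  classical
  have hflow : ∀ j : V, ∃ φ : G.Dart → ℝ, (∀ e, φ e.symm = φ e) ∧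
      (∀ e : G.Dart, ¬(e.fst ∈ H ∧ e.snd ∈ H) → φ e = 0) ∧ (j ∈ honestComponent G H i →
      ∀ k, outflow G φ k = (if i = k then 1 else 0) - if j = k then 1 else 0) := by
    intro j
    by_cases hj : j ∈ honestComponent G H i
    · obtain ⟨hi', hj', ⟨q⟩⟩ := hj
      obtain ⟨φ, h1, h2, h3⟩ := exists_flow q.reverse
      exact ⟨φ, h1, h2, fun _ => h3⟩
    · exact ⟨fun _ => 0, fun _ => rfl, fun _ _ => rfl, fun h => (hj h).elim⟩
  choose φ hs hz ho using hflow
  set K : Finset V := Finset.univ.filter (· ∈ honestComponent G H i) with hK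
  have hKmem : ∀ j, j ∈ K ↔ j ∈ honestComponent G H i := fun j => by simp [hK]
  set F : G.Dart → (V → ℝ) → ℝ := fun e s => ∑ j ∈ K, s j * φ j e with hFdef
  refine ⟨∑ e, ∫ ω, F e (S · ω) ^ 2 ∂P, fun v Z D hv h => ?_⟩
  have hFL : ∀ e, MemLp (fun ω => F e (S · ω)) 2 P := fun e =>
    memLp_finsetSum _ fun j hj => (hL j ((hKmem j).1 hj)).mul_const _
  have hFm : ∀ e, Measurable (F e) := fun e => by fun_prop
  have hle := mutualInfo_prodMk_masked_le (i := i) hv h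
    (A := fun s => ∑ j ∈ K, s j) (by fun_prop) hFm hFL Finset.univ
  refine le_trans ?_ hle
  simp only [Finset.mem_univ, if_true]
  set Y : Ω → ℝ × (G.Dart → ℝ) := fun ω =>
    (∑ j ∈ K, S j ω, fun e => F e (S · ω) + Z e ω) with hY
  have hYm : Measurable Y := by
    have hSm : Measurable fun ω => (S · ω) := measurable_pi_lambda _ h.measurable_S
    have := h.measurable_S
    exact (Finset.measurable_sum _ fun j _ => h.measurable_S j).prodMk
      (measurable_pi_lambda _ fun e => ((hFm e).comp hSm).add (h.measurable_Z e))
  -- The perturbed quantities are recomputed from gauged data: the whole sum sits at `i`, zero at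
  -- the other nodes, and the initial values are `F e + Z e`.
  have hg := mutualInfo_comp_le (P := P) (h.measurable_S i) hYm
    (g := perturbed G H i (fun k (y : ℝ × (G.Dart → ℝ)) => if k = i then y.1 else 0)
      fun e y => y.2 e)
    (measurable_perturbed H i (fun k => by split_ifs <;> fun_prop) fun e => by fun_prop)
  refine le_trans (le_of_eq ?_) hg
  congr 1
  funext ω
  refine (perturbed_gauge H i (fun e => F e (S · ω)) (fun e => ?_) (fun e he => ?_)
    (fun k hk => ?_) fun e => ?_).symm
  · simp only [hFdef, hs]
  · simp only [hFdef, hz _ e he, mul_zero, Finset.sum_const_zero]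
  · have h1 : outflow G (fun e => F e (S · ω)) k =
        ∑ j ∈ K, S j ω * ((if i = k then 1 else 0) - if j = k then 1 else 0) := by
      rw [outflow_sum]
      exact Finset.sum_congr rfl fun j hj => by rw [ho j ((hKmem j).1 hj)]
    rw [h1]
    simp only [mul_sub, Finset.sum_sub_distrib, mul_ite, mul_one, mul_zero,
      Finset.sum_ite_eq', (hKmem k).2 hk, if_true, hY]
    by_cases hki : k = i
    · simp [hki]
    · simp [hki, Ne.symm hki]
  · simp only [hY]
    ring

end Noise

/-! ### Quantization error without overload -/

section Quantization

theorem abs_quantize_sub_le {p : Params} (hbits : p.bits = ⊤) {t : ℕ} (hw : 0 < p.cellWidth t)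
    (x : ℝ) : |p.quantize t x - x| ≤ p.cellWidth t / 2 := by
  unfold Params.quantize
  have htop : ∀ a, clampIndex ⊤ a = a := fun _ => rfl
  rw [hbits, htop]
  have h1 := Int.floor_le (x / p.cellWidth t)
  have h2 := (Int.lt_floor_add_one (x / p.cellWidth t)).le
  rw [le_div_iff₀ hw] at h1
  rw [div_le_iff₀ hw] at h2
  rw [abs_le]
  constructor <;> nlinarith

theorem cellWidth_pos {p : Params} (hp : p.Valid) (t : ℕ) : 0 < p.cellWidth t :=
  lt_max_of_lt_left (mul_pos (pow_pos hp.γ_pos _) hp.Δ₀_pos)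

theorem tendsto_cellWidth {p : Params} (hp : p.Valid) (hmin : p.Δmin = 0) :
    Tendsto p.cellWidth atTop (𝓝 0) := by
  have h : p.cellWidth = fun t => p.γ ^ t * p.Δ₀ := by
    funext t
    rw [Params.cellWidth, hmin, max_eq_left (mul_pos (pow_pos hp.γ_pos _) hp.Δ₀_pos).le]
  rw [h]
  simpa using (tendsto_pow_atTop_nhds_zero_of_lt_one hp.γ_pos.le hp.γ_lt_one).mul_const p.Δ₀

end Quantization

/-! ### The adversary's estimate of the component sum -/

section Estimator

variable {V : Type*} [Fintype V] [LinearOrder V] (G : SimpleGraph V) [DecidableRel G.Adj]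
  (H : Set V) (i : V) (p : Params) (κ : V → G.Dart)

variable {G} in
/-- The value of the auxiliary variable reconstructed from its initial value `z` and the
messages `m`. -/
noncomputable def zReplay (z : G.Dart → ℝ) (m : ℕ → G.Dart → ℝ) (t : ℕ) (e : G.Dart) : ℝ :=
  z e + ∑ r ∈ Finset.range t, m r e

variable {G} in
/-- The adversary's estimate of `x_j`, read off from the message on the dart `κ j`. -/
noncomputable def xEstimate (z : G.Dart → ℝ) (m : ℕ → G.Dart → ℝ) (t : ℕ) (j : V) : ℝ :=
  (m t (κ j) / (1 - p.θ) - (zReplay z m t (κ j).symm - zReplay z m t (κ j))) /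
    (2 * p.c * weight (κ j).symm)

open scoped Classical in
/-- The adversary's estimate of the sum of the private data over the honest component of `i`. -/
noncomputable def sumEstimate (z : G.Dart → ℝ) (m : ℕ → G.Dart → ℝ) (t : ℕ) : ℝ :=
  ∑ j : V with j ∈ honestComponent G H i, (1 + p.c * G.degree j) * xEstimate p κ z m t j +
    ∑ e : G.Dart with e.fst ∈ honestComponent G H i ∧ e.snd ∉ H, weight e * zReplay z m t e -
    2⁻¹ * ∑ e : G.Dart with e.fst ∈ honestComponent G H i ∧ e.snd ∈ honestComponent G H i,
      weight e * (m t e / (1 - p.θ) - 2 * p.c * weight e.symm * xEstimate p κ z m t e.snd)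

variable {G H i p κ}

theorem zHat_eq_zReplay (s : V → ℝ) (z : G.Dart → ℝ) (d : ℕ × G.Dart → ℝ) (t : ℕ) :
    zHat G p s z d t = zReplay z (message G p s z d) t := by
  induction t with
  | zero => funext e; simp [zReplay, zHat]
  | succ t ih =>
    funext e
    have h : zHat G p s z d (t + 1) e = zHat G p s z d t e + message G p s z d t e := rfl
    rw [h, ih, zReplay, zReplay, Finset.sum_range_succ, add_assoc]

/-- The estimate replays `ẑ` only on edges with a corrupt end and uses messages of index at most
`t`, so it can be computed from the view. -/
theorem sumEstimate_congr (hκ : ∀ j ∈ H, (κ j).fst ∉ H) {z z' : G.Dart → ℝ}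
    {m m' : ℕ → G.Dart → ℝ} {t : ℕ} (hz : ∀ e : G.Dart, ¬(e.fst ∈ H ∧ e.snd ∈ H) → z e = z' e)
    (hm : ∀ r ≤ t, m r = m' r) :
    sumEstimate G H i p κ z m t = sumEstimate G H i p κ z' m' t := by
  have h1 : ∀ e : G.Dart, ¬(e.fst ∈ H ∧ e.snd ∈ H) → zReplay z m t e = zReplay z' m' t e := by
    intro e he
    unfold zReplay
    rw [hz e he]
    congr 1
    exact Finset.sum_congr rfl fun r hr => by rw [hm r (Finset.mem_range.1 hr).le]
  have h2 : ∀ j ∈ honestComponent G H i, xEstimate p κ z m t j = xEstimate p κ z' m' t j := by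
    intro j hj
    have hc := hκ j (honestComponent_subset hj)
    unfold xEstimate
    rw [hm t le_rfl, h1 _ fun h => hc h.1, h1 _ fun h => hc h.2]
  classical
  unfold sumEstimate
  congr 1
  · congr 1
    · refine Finset.sum_congr rfl fun j hj => ?_
      rw [h2 j (Finset.mem_filter.1 hj).2]
    · refine Finset.sum_congr rfl fun e he => ?_
      rw [h1 e fun h => (Finset.mem_filter.1 he).2.2 h.2]
  · congr 1
    refine Finset.sum_congr rfl fun e he => ?_
    rw [hm t le_rfl, h2 _ (Finset.mem_filter.1 he).2.2]

/-- The scaled quantization error of a message. -/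
noncomputable def messageError (p : Params) (s : V → ℝ) (z : G.Dart → ℝ) (d : ℕ × G.Dart → ℝ)
    (t : ℕ) (e : G.Dart) : ℝ :=
  message G p s z d t e / (1 - p.θ) - (zHat G p s z d t e.symm - zHat G p s z d t e +
    2 * p.c * weight e.symm * xUpdate G p s (zHat G p s z d t) e.snd)

/-- The subtractive dither cancels: the error is that of `Q` at the dithered input, at most half a
cell width for every value of the dither. The convergence is therefore sure and uses no law of the
dithers. -/
theorem tendsto_messageError (hp : p.Valid) (hmin : p.Δmin = 0) (hbits : p.bits = ⊤) (s : V → ℝ)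
    (z : G.Dart → ℝ) (d : ℕ × G.Dart → ℝ) (e : G.Dart) :
    Tendsto (fun t => messageError p s z d t e) atTop (𝓝 0) := by
  have hθ : 0 < 1 - p.θ := sub_pos.2 hp.θ_lt_one
  have hlim : Tendsto (fun t => p.cellWidth (t + 1) / 2 / (1 - p.θ)) atTop (𝓝 0) := by
    simpa using (((tendsto_cellWidth hp hmin).comp (tendsto_add_atTop_nat 1)).div_const 2).div_const
      (1 - p.θ)
  refine squeeze_zero_norm (fun t => ?_) hlim
  rw [Real.norm_eq_abs, le_div_iff₀ hθ, ← abs_of_pos hθ, ← abs_mul]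
  have h := abs_quantize_sub_le hbits (cellWidth_pos hp (t + 1))
    (zUpdate G p s (zHat G p s z d t) e - zHat G p s z d t e + d (t + 1, e))
  refine le_trans (le_of_eq ?_) h
  congr 1
  rw [messageError, message, increment, Params.ditheredQuantize]
  unfold zUpdate
  field_simp
  ring

theorem xEstimate_eq (hp : p.Valid) {j : V} (hκ : (κ j).snd = j) (s : V → ℝ) (z : G.Dart → ℝ)
    (d : ℕ × G.Dart → ℝ) (t : ℕ) :
    xEstimate p κ z (message G p s z d) t j = xUpdate G p s (zHat G p s z d t) j +
      messageError p s z d t (κ j) / (2 * p.c * weight (κ j).symm) := by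
  have hc := hp.c_pos.ne'
  have hw : weight (κ j).symm ≠ 0 := fun h => by simpa [h] using weight_mul_self (κ j).symm
  rw [xEstimate, messageError, ← zHat_eq_zReplay, hκ]
  field_simp
  ring

-- Solve each `x`-update for `s_j` and sum. On edges inside the component only the differences of
-- `z` survive.
open scoped Classical in
theorem sum_private_eq (hp : p.Valid) (s : V → ℝ) (z : G.Dart → ℝ) :
    ∑ j : V with j ∈ honestComponent G H i, s j =
      ∑ j : V with j ∈ honestComponent G H i, (1 + p.c * G.degree j) * xUpdate G p s z j +
      ∑ e : G.Dart with e.fst ∈ honestComponent G H i ∧ e.snd ∉ H, weight e * z e -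
      2⁻¹ * ∑ e : G.Dart with e.fst ∈ honestComponent G H i ∧ e.snd ∈ honestComponent G H i,
        weight e * (z e.symm - z e) := by
  have h1 : ∀ j, s j = (1 + p.c * G.degree j) * xUpdate G p s z j +
      (∑ e : G.Dart with e.fst = j ∧ e.snd ∉ H, weight e * z e +
        ∑ e : G.Dart with e.fst = j ∧ e.snd ∈ H, weight e * z e) := by
    intro j
    have hpos : 0 < 1 + p.c * G.degree j :=
      add_pos_of_pos_of_nonneg one_pos (mul_nonneg hp.c_pos.le (Nat.cast_nonneg _))
    have h2 : ∑ e : G.Dart with e.fst = j, weight e * z e =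
        ∑ e : G.Dart with e.fst = j ∧ e.snd ∉ H, weight e * z e +
        ∑ e : G.Dart with e.fst = j ∧ e.snd ∈ H, weight e * z e := by
      rw [← Finset.filter_filter, ← Finset.filter_filter, add_comm]
      exact (Finset.sum_filter_add_sum_filter_not _ _ _).symm
    rw [xUpdate, mul_div_cancel₀ _ hpos.ne', ← h2]
    ring
  rw [Finset.sum_congr rfl fun j _ => h1 j, Finset.sum_add_distrib, Finset.sum_add_distrib,
    sum_component_fst, sum_component_fst, sum_weight_component]
  simp only [mul_sub, Finset.sum_sub_distrib]
  ring

open scoped Classical in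
/-- With a quantizer which does not overload, the adversary's estimate converges. -/
theorem tendsto_sumEstimate (hp : p.Valid) (hmin : p.Δmin = 0) (hbits : p.bits = ⊤)
    (hκ : ∀ j ∈ H, (κ j).snd = j) (s : V → ℝ) (z : G.Dart → ℝ) (d : ℕ × G.Dart → ℝ) :
    Tendsto (fun t => sumEstimate G H i p κ z (message G p s z d) t) atTop
      (𝓝 (∑ j : V with j ∈ honestComponent G H i, s j)) := by
  set ε : ℕ → V → ℝ := fun t j =>
    messageError p s z d t (κ j) / (2 * p.c * weight (κ j).symm) with hε
  have hM := tendsto_messageError hp hmin hbits s z d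
  have hε0 : ∀ j, Tendsto (fun t => ε t j) atTop (𝓝 0) := fun j => by
    simpa using (hM (κ j)).div_const (2 * p.c * weight (κ j).symm)
  have hx : ∀ t, ∀ j ∈ honestComponent G H i, xEstimate p κ z (message G p s z d) t j =
      xUpdate G p s (zHat G p s z d t) j + ε t j := fun t j hj =>
    xEstimate_eq hp (hκ j (honestComponent_subset hj)) s z d t
  -- The identity `sum_private_eq` holds exactly at `ẑ^(t)`, so the estimate misses the sum by a
  -- fixed linear combination of message errors.
  have key : ∀ t, sumEstimate G H i p κ z (message G p s z d) t =
      ∑ j : V with j ∈ honestComponent G H i, s j +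
      (∑ j : V with j ∈ honestComponent G H i, (1 + p.c * G.degree j) * ε t j -
        2⁻¹ * ∑ e : G.Dart with e.fst ∈ honestComponent G H i ∧ e.snd ∈ honestComponent G H i,
          weight e * (messageError p s z d t e - 2 * p.c * weight e.symm * ε t e.snd)) := by
    intro t
    have h1 : ∑ j : V with j ∈ honestComponent G H i,
        (1 + p.c * G.degree j) * xEstimate p κ z (message G p s z d) t j =
        ∑ j : V with j ∈ honestComponent G H i,
          (1 + p.c * G.degree j) * xUpdate G p s (zHat G p s z d t) j +
        ∑ j : V with j ∈ honestComponent G H i, (1 + p.c * G.degree j) * ε t j := by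
      rw [← Finset.sum_add_distrib]
      refine Finset.sum_congr rfl fun j hj => ?_
      rw [hx t j (Finset.mem_filter.1 hj).2, mul_add]
    have h2 : ∑ e : G.Dart with e.fst ∈ honestComponent G H i ∧ e.snd ∈ honestComponent G H i,
        weight e * (message G p s z d t e / (1 - p.θ) -
          2 * p.c * weight e.symm * xEstimate p κ z (message G p s z d) t e.snd) =
        ∑ e : G.Dart with e.fst ∈ honestComponent G H i ∧ e.snd ∈ honestComponent G H i,
          weight e * (zHat G p s z d t e.symm - zHat G p s z d t e) +
        ∑ e : G.Dart with e.fst ∈ honestComponent G H i ∧ e.snd ∈ honestComponent G H i,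
          weight e * (messageError p s z d t e - 2 * p.c * weight e.symm * ε t e.snd) := by
      rw [← Finset.sum_add_distrib]
      refine Finset.sum_congr rfl fun e he => ?_
      rw [hx t _ (Finset.mem_filter.1 he).2.2, messageError]
      ring
    rw [sumEstimate, h1, h2, ← zHat_eq_zReplay, sum_private_eq hp s (zHat G p s z d t)]
    ring
  simp_rw [key]
  have hz : Tendsto (fun t =>
      ∑ j : V with j ∈ honestComponent G H i, (1 + p.c * G.degree j) * ε t j -
        2⁻¹ * ∑ e : G.Dart with e.fst ∈ honestComponent G H i ∧ e.snd ∈ honestComponent G H i,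
          weight e * (messageError p s z d t e - 2 * p.c * weight e.symm * ε t e.snd)) atTop
      (𝓝 (∑ j : V with j ∈ honestComponent G H i, (1 + p.c * G.degree j) * 0 -
        2⁻¹ * ∑ e : G.Dart with e.fst ∈ honestComponent G H i ∧ e.snd ∈ honestComponent G H i,
          weight e * (0 - 2 * p.c * weight e.symm * 0))) :=
    (tendsto_finsetSum _ fun j _ => (hε0 j).const_mul _).sub
      ((tendsto_finsetSum _ fun e _ => ((hM e).sub ((hε0 e.snd).const_mul _)).const_mul _).const_mul
        _)
  simpa using hz.const_add (∑ j : V with j ∈ honestComponent G H i, s j)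

theorem measurable_sumEstimate {α : Type*} [MeasurableSpace α] {z : α → G.Dart → ℝ}
    {m : α → ℕ → G.Dart → ℝ} (hz : ∀ e, Measurable fun a => z a e)
    (hm : ∀ r e, Measurable fun a => m a r e) (t : ℕ) :
    Measurable fun a => sumEstimate G H i p κ (z a) (m a) t := by
  unfold sumEstimate xEstimate zReplay
  fun_prop

end Estimator

/-! ### The view is at least as informative as the component sum -/

section LowerBound

variable {V : Type*} [Fintype V] [LinearOrder V] {G : SimpleGraph V} [DecidableRel G.Adj]
  {H : Set V} {i : V} {p : Params} {κ : V → G.Dart} {Ω : Type*} [MeasurableSpace Ω]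
  {P : Measure Ω} [IsProbabilityMeasure P] {v : ℝ≥0} {S : V → Ω → ℝ} {Z : G.Dart → Ω → ℝ}
  {D : ℕ × G.Dart → Ω → ℝ}

theorem mutualInfo_sumEstimate_le (h : IsRandomness G P p v S Z D) (hκ : ∀ j ∈ H, (κ j).fst ∉ H)
    {t : ℕ} {T : ℕ∞} (ht : (t : ℕ∞) < T) :
    mutualInfo P (S i) (fun ω => sumEstimate G H i p κ (Z · ω)
        (message G p (S · ω) (Z · ω) (D · ω)) t) ≤
      mutualInfo P (S i) (view G H p S Z D T) := by
  classical
  have hle := mutualInfo_comp_le (P := P) (h.measurable_S i)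
    (measurable_view H p h.measurable_S h.measurable_Z h.measurable_D T)
    (g := fun y => sumEstimate G H i p κ
      (fun e => if he : ¬(e.fst ∈ H ∧ e.snd ∈ H) then y.2.1 ⟨e, he⟩ else 0)
      (fun r e => if hr : (r : ℕ∞) < T then y.2.2 (⟨r, hr⟩, e) else 0) t)
    (measurable_sumEstimate (fun e => by split_ifs <;> fun_prop)
      (fun r e => by split_ifs <;> fun_prop) t)
  refine le_trans (le_of_eq ?_) hle
  congr 1
  funext ω
  refine sumEstimate_congr hκ (fun e he => ?_) fun r hr => ?_
  · rw [dif_pos he]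
    rfl
  · funext e
    rw [dif_pos (lt_of_le_of_lt (by exact_mod_cast hr) ht)]
    rfl

theorem mutualInfo_componentSum_le_liminf (h : IsRandomness G P p v S Z D) (hp : p.Valid)
    (hmin : p.Δmin = 0) (hbits : p.bits = ⊤) (hκ : ∀ j ∈ H, (κ j).snd = j) :
    mutualInfo P (S i) (componentSum G H i S) ≤
      liminf (fun t : ℕ => mutualInfo P (S i) fun ω => sumEstimate G H i p κ (Z · ω)
        (message G p (S · ω) (Z · ω) (D · ω)) t) atTop := by
  refine mutualInfo_le_liminf (h.measurable_S i) (measurable_componentSum H i h.measurable_S)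
    (fun t => measurable_sumEstimate h.measurable_Z (fun r e => ?_) t) fun ω =>
      tendsto_sumEstimate hp hmin hbits hκ _ _ _
  exact measurable_increment p h.measurable_S h.measurable_D r
    (measurable_zHat p h.measurable_S h.measurable_Z h.measurable_D r) e

theorem mutualInfo_componentSum_le_view (h : IsRandomness G P p v S Z D) (hp : p.Valid)
    (hmin : p.Δmin = 0) (hbits : p.bits = ⊤) (hcorrupt : ∀ j ∈ H, ∃ k, k ∉ H ∧ G.Adj j k)
    (hi : i ∈ H) :
    mutualInfo P (S i) (componentSum G H i S) ≤
        liminf (fun T : ℕ => mutualInfo P (S i) (view G H p S Z D T)) atTop ∧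
      mutualInfo P (S i) (componentSum G H i S) ≤ mutualInfo P (S i) (view G H p S Z D ⊤) := by
  obtain ⟨κ, hκ⟩ : ∃ κ : V → G.Dart, ∀ j ∈ H, (κ j).fst ∉ H ∧ (κ j).snd = j := by
    have hex : ∀ j, ∃ e : G.Dart, j ∈ H → e.fst ∉ H ∧ e.snd = j := by
      intro j
      by_cases hj : j ∈ H
      · obtain ⟨k, hk, hadj⟩ := hcorrupt j hj
        exact ⟨⟨(k, j), hadj.symm⟩, fun _ => ⟨hk, rfl⟩⟩
      -- For a corrupt `j` any dart will do; the corrupt neighbour of `i` provides one.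
      · obtain ⟨k, -, hadj⟩ := hcorrupt i hi
        exact ⟨⟨(i, k), hadj⟩, fun hj' => (hj hj').elim⟩
    choose κ hκ using hex
    exact ⟨κ, hκ⟩
  have hlim := mutualInfo_componentSum_le_liminf (i := i) h hp hmin hbits fun j hj => (hκ j hj).2
  constructor
  -- The estimate at index `t` uses the messages `0, …, t`, that is, a run of `t + 1` iterations.
  · rw [← liminf_nat_add _ 1]
    refine hlim.trans (liminf_le_liminf (Eventually.of_forall fun t => ?_))
    exact mutualInfo_sumEstimate_le h (fun j hj => (hκ j hj).1) (by exact_mod_cast t.lt_succ_self)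
  · refine hlim.trans ((liminf_le_liminf (v := fun _ => mutualInfo P (S i) (view G H p S Z D ⊤))
      (Eventually.of_forall fun t => ?_)).trans (liminf_const _).le)
    exact mutualInfo_sumEstimate_le h (fun j hj => (hκ j hj).1) (WithTop.coe_lt_top t)

end LowerBound

/-! ### The limit of large noise -/

section Limit

variable {V : Type*} [Fintype V] [LinearOrder V] {G : SimpleGraph V} [DecidableRel G.Adj]
  {H : Set V} {i : V} {p : Params} {Ω : Type*} [MeasurableSpace Ω] {P : Measure Ω}
  [IsProbabilityMeasure P] {S : V → Ω → ℝ} {Z : ℝ≥0 → G.Dart → Ω → ℝ} {D : ℕ × G.Dart → Ω → ℝ}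

theorem tendsto_mutualInfo_perturbed
    (hrand : ∀ v : ℝ≥0, 0 < v → IsRandomness G P p v S (Z v) D)
    (hL : ∀ j ∈ honestComponent G H i, MemLp (S j) 2 P) :
    Tendsto (fun v : ℝ≥0 => mutualInfo P (S i) (perturbed G H i S (Z v))) atTop
      (𝓝 (mutualInfo P (S i) (componentSum G H i S))) := by
  obtain ⟨C, hC⟩ := exists_mutualInfo_perturbed_le (p := p) hL
  have h0 : Tendsto (fun v : ℝ≥0 => C / (2 * v)) atTop (𝓝 0) :=
    Tendsto.const_div_atTop (Tendsto.const_mul_atTop two_pos (NNReal.tendsto_coe_atTop.2 tendsto_id))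
      C
  have h1 : Tendsto (fun v : ℝ≥0 => mutualInfo P (S i) (componentSum G H i S) +
      ENNReal.ofReal (C / (2 * v))) atTop (𝓝 (mutualInfo P (S i) (componentSum G H i S))) := by
    simpa using tendsto_const_nhds.add ((ENNReal.continuous_ofReal.tendsto _).comp h0)
  refine tendsto_of_tendsto_of_tendsto_of_le_of_le' tendsto_const_nhds h1 ?_ ?_
  · filter_upwards [eventually_gt_atTop 0] with v hv
    exact mutualInfo_componentSum_le_perturbed (hrand v hv).measurable_S (hrand v hv).measurable_Z
  · filter_upwards [eventually_gt_atTop 0] with v hv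
    exact hC v (Z v) D hv.ne' (hrand v hv)

end Limit

end ADQSP

open ADQSP in
theorem mainTheorem1 {V : Type*} [Fintype V] [LinearOrder V] (G : SimpleGraph V)
    [DecidableRel G.Adj] (hG : G.Connected)
    (H : Set V) (hcorrupt : ∀ j ∈ H, ∃ k, k ∉ H ∧ G.Adj j k) (i : V) (hi : i ∈ H)
    (p : Params) (hp : p.Valid) (hmin : p.Δmin = 0)
    {Ω : Type*} [MeasurableSpace Ω] (P : Measure Ω) [IsProbabilityMeasure P]
    (S : V → Ω → ℝ) (Z : ℝ≥0 → G.Dart → Ω → ℝ) (D : ℕ × G.Dart → Ω → ℝ)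
    (hrand : ∀ v : ℝ≥0, 0 < v → IsRandomness G P p v S (Z v) D) :
    -- the upper bound, for every noise variance and every number of iterations
    (∀ v : ℝ≥0, 0 < v → ∀ T : ℕ∞,
      mutualInfo P (S i) (view G H p S (Z v) D T) ≤
        mutualInfo P (S i) (perturbed G H i S (Z v))) ∧
    -- the limit of the upper bound as the noise variance tends to infinity
    ((∀ j ∈ honestComponent G H i, MemLp (S j) 2 P) →
      Tendsto (fun v : ℝ≥0 => mutualInfo P (S i) (perturbed G H i S (Z v))) atTop
        (𝓝 (mutualInfo P (S i) (componentSum G H i S))) ∧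
      ∀ T : ℕ∞, limsup (fun v : ℝ≥0 => mutualInfo P (S i) (view G H p S (Z v) D T)) atTop ≤
        mutualInfo P (S i) (componentSum G H i S)) ∧
    -- the lower bound as the number of iterations tends to infinity
    (p.bits = ⊤ → ∀ v : ℝ≥0, 0 < v →
      mutualInfo P (S i) (componentSum G H i S) ≤
        liminf (fun T : ℕ => mutualInfo P (S i) (view G H p S (Z v) D T)) atTop ∧
      mutualInfo P (S i) (componentSum G H i S) ≤
        mutualInfo P (S i) (view G H p S (Z v) D ⊤)) ∧
    -- the leakage matches the one of the redefined ideal world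
    mutualInfo P (S i) (idealView G H S) = mutualInfo P (S i) (componentSum G H i S) ∧
    (p.bits = ⊤ → (∀ j ∈ honestComponent G H i, MemLp (S j) 2 P) →
      Tendsto (fun v : ℝ≥0 => mutualInfo P (S i) (view G H p S (Z v) D ⊤)) atTop
        (𝓝 (mutualInfo P (S i) (idealView G H S)))) := by
  have h1 : ∀ v : ℝ≥0, 0 < v → ∀ T : ℕ∞, mutualInfo P (S i) (view G H p S (Z v) D T) ≤
      mutualInfo P (S i) (perturbed G H i S (Z v)) := fun v hv T =>
    mutualInfo_view_le (hrand v hv) hi T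
  have h3 : p.bits = ⊤ → ∀ v : ℝ≥0, 0 < v → _ := fun hbits v hv =>
    mutualInfo_componentSum_le_view (hrand v hv) hp hmin hbits hcorrupt hi
  -- The ideal view does not involve the noise; any positive variance supplies the independence of
  -- the private data.
  have h4 := mutualInfo_idealView (hrand 1 one_pos) hi
  refine ⟨h1, fun hL => ⟨tendsto_mutualInfo_perturbed hrand hL, fun T => ?_⟩, h3, h4,
    fun hbits hL => ?_⟩
  · rw [← (tendsto_mutualInfo_perturbed hrand hL).limsup_eq]
    refine limsup_le_limsup ?_
    filter_upwards [eventually_gt_atTop 0] with v hv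
    exact h1 v hv T
  · rw [h4]
    refine tendsto_of_tendsto_of_tendsto_of_le_of_le' tendsto_const_nhds
      (tendsto_mutualInfo_perturbed hrand hL) ?_ ?_
    · filter_upwards [eventually_gt_atTop 0] with v hv
      exact (h3 hbits v hv).2
    · filter_upwards [eventually_gt_atTop 0] with v hv
      exact h1 v hv ⊤
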